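/- Let $\mathbb F$ be $\mathbb R$ or $\mathbb C$. Given a $\sigma$-finite measure space $(\Omega,\Sigma,\mu)$, a *function norm* is a map $\rho\colon L_0^+(\mu)\to[0,\infty]$ on the (classes of) $[0,\infty]$-valued measurable functions such that: $\rho(f)=0$ iff $f=0$ a.e.; $\rho(f+g)\le\rho(f)+\rho(g)$; $\rho(tf)=t\rho(f)$ for $t\in[0,\infty]$; $\rho(f)\le\rho(g)$ if $f\le g$ a.e.; $\rho(\chi_E)<\infty$ if $\mu(E)<\infty$; $\rho(\lim_n f_n)=\lim_n\rho(f_n)$ for non-decreasing sequences $(f_n)$; and for every $E$ with $\mu(E)<\infty$ there is a constant $C_E$ with $\int_E f\,d\mu\le C_E\,\rho(f)$ for all $f$. Its *function space* is the Banach space $L_\rho=\{f\in L_0(\mu)\colon\rho(|f|)<\infty\}$ of $\mathbb F$-valued functions with norm $\|f\|_\rho=\rho(|f|)$. For $1\le r<\infty$, $\rho$ (or $L_\rho$) is *lattice $r$-convex* (resp. *lattice $r$-concave*) if there is a constant $C$ such that $A\le CB$ (resp. $B\le CA$) for every finite family $(f_i)$ in $L_0^+(\mu)$, where $A=\rho\big((\sum_i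 f_i^r)^{1/r}\big)$ and $B=\big(\sum_i\rho(f_i)^r\big)^{1/r}$; it satisfies an *upper* (resp. *lower*) *$r$-estimate* if $A\le CB$ (resp. $B\le CA$) holds for all finite disjointly supported families. It has *nontrivial concavity* if it is lattice $r$-concave for some $r<\infty$. A Banach space $X$ has *Rademacher type $2$* if there is $C$ such that the average of $\|\sum_i\varepsilon_i x_i\|$ over all signs $\varepsilon_i=\pm1$ is at most $C(\sum_i\|x_i\|^2)^{1/2}$ for all finite families $(x_i)$ in $X$. A sequence $(x_n)_{n=1}^\infty$ in a Banach space is *semi-normalized* if $0<\inf_n\|x_n\|\le\sup_n\|x_n\|<\infty$, and it is an *unconditional basic sequence* if it is an unconditional Schauder basis of its closed linear span $[x_n]$. Sequences $(x_n)$ and $(y_n)$ in Banach spaces $X$ and $Y$ are *equivalent* if there are bounded linear maps $S\colon[x_n]\to Y$ and $T\colon[y_n]\to X$ with $S(x_n)=y_n$ and $T(y_n)=x_n$ for all $n$. A sequence $(f_n)$ in $L_0(\mu)$ *escapes to infinity* if $\lim_n\operatorname{ess\,inf}\{|f_n(\omega)|\colon f_n(\omega)\neq0\}=\infty$. **Theorem.**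 Let $N\ge1$ and, for $j=1,\dots,N$, let $\rho_j$ be a function norm over a $\sigma$-finite measure space $(\Omega_j,\Sigma_j,\mu_j)$. Suppose that there is an increasing tuple $(p_j)_{j=1}^{N-1}$ in $(2,\infty)$ such that * $L_{\rho_j}\subseteq L_2(\mu_j)$ and $L_{\rho_j}$ has Rademacher type $2$ for all $j=1,\dots,N$; * $L_{\rho_1}$ is lattice $2$-convex; * $L_{\rho_N}$ has nontrivial concavity; and * $L_{\rho_j}$ satisfies a lower $p_j$-estimate and $L_{\rho_{j+1}}$ satisfies an upper $p_j$-estimate for all $j=1,\dots,N-1$. Let $\Psi$ be a semi-normalized unconditional basic sequence (not necessarily complemented) in the direct sum $\bigoplus_{j=1}^N L_{\rho_j}$, endowed with the norm $\max_j\|f_j\|_{\rho_j}$. Then either $\Psi$ is equivalent to the unit vector system of $\ell_2$, or there is $j\in\{1,\dots,N\}$ such that $\Psi$ has a subsequence equivalent to an unconditional basic sequence in $L_{\rho_j}$ that consists of pairwise disjointly supported simple functions and that, if $\mu_j(\Omega_j)<\infty$, escapes to infinity. -/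

import Mathlib

open MeasureTheory Filter Topology
open scoped ENNReal NNReal

noncomputable section

/-! ### Function norms and function spaces -/

/-- A function norm over `(Ω, μ)`: a map `ρ` from the `[0, ∞]`-valued measurable functions to
`[0, ∞]`. The map is recorded on all functions `Ω → [0, ∞]`, but the axioms (and every use below)
only concern the measurable ones; by `mono`, functions which agree almost everywhere have the same
value. -/
structure FunctionNorm {Ω : Type*} [MeasurableSpace Ω] (μ : Measure Ω) where
  toFun : (Ω → ℝ≥0∞) → ℝ≥0∞
  eq_zero_iff : ∀ f, Measurable f → (toFun f = 0 ↔ f =ᵐ[μ] 0)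
  add_le : ∀ f g, Measurable f → Measurable g →
    toFun (fun ω => f ω + g ω) ≤ toFun f + toFun g
  const_mul : ∀ (t : ℝ≥0∞) (f), Measurable f → toFun (fun ω => t * f ω) = t * toFun f
  mono : ∀ f g, Measurable f → Measurable g → f ≤ᵐ[μ] g → toFun f ≤ toFun g
  indicator_lt_top : ∀ E, MeasurableSet E → μ E < ∞ →
    toFun (E.indicator fun _ => 1) < ∞
  iSup_eq : ∀ f : ℕ → Ω → ℝ≥0∞, (∀ n, Measurable (f n)) → Monotone f →
    toFun (fun ω => ⨆ n, f n ω) = ⨆ n, toFun (f n)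
  lintegral_le : ∀ E, MeasurableSet E → μ E < ∞ →
    ∃ C : ℝ≥0, ∀ f, Measurable f → ∫⁻ ω in E, f ω ∂μ ≤ C * toFun f

namespace FunctionNorm

variable {Ω : Type*} [MeasurableSpace Ω] {μ : Measure Ω}

instance : CoeFun (FunctionNorm μ) fun _ => (Ω → ℝ≥0∞) → ℝ≥0∞ := ⟨toFun⟩

theorem congr_ae (ρ : FunctionNorm μ) {f g : Ω → ℝ≥0∞} (hf : Measurable f) (hg : Measurable g)
    (h : f =ᵐ[μ] g) : ρ f = ρ g :=
  le_antisymm (ρ.mono f g hf hg h.le) (ρ.mono g f hg hf h.symm.le)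

/-- `ρ(|f|)`, for `f` in `L₀(μ)`. -/
def gauge {𝕜 : Type*} [RCLike 𝕜] (ρ : FunctionNorm μ) (f : Ω →ₘ[μ] 𝕜) : ℝ≥0∞ :=
  ρ fun ω => ‖f ω‖ₑ

section gauge

variable {𝕜 : Type*} [RCLike 𝕜] (ρ : FunctionNorm μ)

theorem measurable_enorm (f : Ω →ₘ[μ] 𝕜) : Measurable fun ω => ‖f ω‖ₑ :=
  f.stronglyMeasurable.enorm

theorem gauge_le {f : Ω →ₘ[μ] 𝕜} {g : Ω → ℝ≥0∞} (hg : Measurable g)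
    (h : ∀ᵐ ω ∂μ, ‖f ω‖ₑ ≤ g ω) : ρ.gauge f ≤ ρ g :=
  ρ.mono _ _ (measurable_enorm f) hg h

theorem gauge_eq_zero {f : Ω →ₘ[μ] 𝕜} : ρ.gauge f = 0 ↔ f = 0 := by
  rw [gauge, ρ.eq_zero_iff _ (measurable_enorm f)]
  constructor
  · intro h
    refine AEEqFun.ext ?_
    filter_upwards [h, AEEqFun.coeFn_zero (α := Ω) (β := 𝕜) (μ := μ)] with ω h1 h2
    rw [h2]
    simpa using h1
  · rintro rfl
    filter_upwards [AEEqFun.coeFn_zero (α := Ω) (β := 𝕜) (μ := μ)] with ω h2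
    rw [h2]
    simp

theorem gauge_add_le (f g : Ω →ₘ[μ] 𝕜) : ρ.gauge (f + g) ≤ ρ.gauge f + ρ.gauge g := by
  refine le_trans (ρ.gauge_le ((measurable_enorm f).add (measurable_enorm g)) ?_)
    (ρ.add_le _ _ (measurable_enorm f) (measurable_enorm g))
  filter_upwards [AEEqFun.coeFn_add f g] with ω h
  rw [h]
  exact enorm_add_le _ _

theorem gauge_smul (c : 𝕜) (f : Ω →ₘ[μ] 𝕜) : ρ.gauge (c • f) = ‖c‖ₑ * ρ.gauge f := by
  rw [gauge, gauge, ← ρ.const_mul _ _ (measurable_enorm f)]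
  refine ρ.congr_ae (measurable_enorm _) ((measurable_enorm f).const_mul _) ?_
  filter_upwards [AEEqFun.coeFn_smul c f] with ω h
  rw [h]
  simp [enorm_mul]

end gauge

/-- The function space `L_ρ = {f ∈ L₀(μ) : ρ(|f|) < ∞}`. -/
def space (ρ : FunctionNorm μ) (𝕜 : Type*) [RCLike 𝕜] : Submodule 𝕜 (Ω →ₘ[μ] 𝕜) where
  carrier := {f | ρ.gauge f < ∞}
  zero_mem' := by
    change ρ.gauge 0 < ∞
    rw [ρ.gauge_eq_zero.2 rfl]
    exact ENNReal.zero_lt_top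
  add_mem' {f g} hf hg := (ρ.gauge_add_le f g).trans_lt (ENNReal.add_lt_top.2 ⟨hf, hg⟩)
  smul_mem' c f hf := by
    change ρ.gauge (c • f) < ∞
    rw [ρ.gauge_smul]
    exact ENNReal.mul_lt_top enorm_lt_top hf

section space

variable {𝕜 : Type*} [RCLike 𝕜] {ρ : FunctionNorm μ}

/-- The norm `‖f‖_ρ = ρ(|f|)` of `L_ρ`. -/
instance : Norm (ρ.space 𝕜) := ⟨fun f => (ρ.gauge f.1).toReal⟩

theorem norm_def (f : ρ.space 𝕜) : ‖f‖ = (ρ.gauge f.1).toReal := rfl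

theorem gauge_ne_top (f : ρ.space 𝕜) : ρ.gauge f.1 ≠ ∞ := f.2.ne

theorem space_core : NormedSpace.Core 𝕜 (ρ.space 𝕜) where
  norm_nonneg _ := ENNReal.toReal_nonneg
  norm_smul c f := by
    rw [norm_def, norm_def, Submodule.coe_smul, ρ.gauge_smul, ENNReal.toReal_mul, toReal_enorm]
  norm_triangle f g := by
    rw [norm_def, norm_def, norm_def, ← ENNReal.toReal_add (gauge_ne_top f) (gauge_ne_top g)]
    exact ENNReal.toReal_mono (ENNReal.add_ne_top.2 ⟨gauge_ne_top f, gauge_ne_top g⟩)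
      (ρ.gauge_add_le _ _)
  norm_eq_zero_iff f := by
    rw [norm_def, ENNReal.toReal_eq_zero_iff, or_iff_left (gauge_ne_top f), ρ.gauge_eq_zero,
      Submodule.coe_eq_zero]

instance : NormedAddCommGroup (ρ.space 𝕜) := NormedAddCommGroup.ofCore space_core

instance : NormedSpace 𝕜 (ρ.space 𝕜) := NormedSpace.ofCore space_core

theorem ofReal_norm_eq (f : ρ.space 𝕜) : ENNReal.ofReal ‖f‖ = ρ.gauge f.1 :=
  ENNReal.ofReal_toReal (gauge_ne_top f)

theorem finset_sum_le (ρ : FunctionNorm μ) {ι : Type*} (s : Finset ι) (f : ι → Ω → ℝ≥0∞)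
    (hf : ∀ i, Measurable (f i)) : ρ (fun ω => ∑ i ∈ s, f i ω) ≤ ∑ i ∈ s, ρ (f i) := by
  classical
  induction s using Finset.induction_on with
  | empty =>
    simp only [Finset.sum_empty, nonpos_iff_eq_zero]
    exact (ρ.eq_zero_iff _ measurable_const).2 (Eventually.of_forall fun _ => rfl)
  | insert a s ha ih =>
    simp only [Finset.sum_insert ha]
    refine (ρ.add_le _ _ (hf a) (Finset.measurable_fun_sum s fun i _ => hf i)).trans ?_
    gcongr

theorem tsum_le (ρ : FunctionNorm μ) (f : ℕ → Ω → ℝ≥0∞) (hf : ∀ i, Measurable (f i)) :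
    ρ (fun ω => ∑' i, f i ω) ≤ ∑' i, ρ (f i) := by
  simp only [ENNReal.tsum_eq_iSup_nat]
  rw [ρ.iSup_eq (fun n ω => ∑ i ∈ Finset.range n, f i ω)
    (fun n => Finset.measurable_fun_sum _ fun i _ => hf i)]
  · exact iSup_mono fun n => ρ.finset_sum_le _ f hf
  · intro m n hmn ω
    exact Finset.sum_le_sum_of_subset (Finset.range_mono hmn)

theorem ae_lt_top (ρ : FunctionNorm μ) {f : Ω → ℝ≥0∞} (hf : Measurable f) (h : ρ f < ∞) :
    ∀ᵐ ω ∂μ, f ω < ∞ := by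
  have hm : MeasurableSet {ω | f ω = ∞} := hf (measurableSet_singleton _)
  have hI : Measurable ({ω | f ω = ∞}.indicator fun _ => (1 : ℝ≥0∞)) :=
    measurable_const.indicator hm
  have h1 : ∞ * ρ ({ω | f ω = ∞}.indicator fun _ => 1) ≤ ρ f := by
    rw [← ρ.const_mul _ _ hI]
    refine ρ.mono _ _ (hI.const_mul _) hf (Eventually.of_forall fun ω => ?_)
    by_cases hω : f ω = ∞ <;> simp [hω]
  have h2 : ρ ({ω | f ω = ∞}.indicator fun _ => 1) = 0 := by
    by_contra h0
    rw [ENNReal.top_mul h0] at h1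
    exact absurd h (not_lt.2 h1)
  filter_upwards [(ρ.eq_zero_iff _ hI).1 h2] with ω hω
  rw [lt_top_iff_ne_top]
  intro h3
  simp [h3] at hω

theorem coeFn_finset_sum (s : Finset ℕ) (u : ℕ → ρ.space 𝕜) :
    ∀ᵐ ω ∂μ, (∑ i ∈ s, u i).1 ω = ∑ i ∈ s, (u i).1 ω := by
  classical
  induction s using Finset.induction_on with
  | empty =>
    filter_upwards [AEEqFun.coeFn_zero (α := Ω) (β := 𝕜) (μ := μ)] with ω h
    simpa using h
  | insert a s ha ih =>
    rw [Finset.sum_insert ha]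
    filter_upwards [ih, AEEqFun.coeFn_add (u a).1 (∑ i ∈ s, u i).1] with ω h1 h2
    rw [Finset.sum_insert ha, ← h1]
    exact h2

/-- `L_ρ` is a Banach space. -/
instance : CompleteSpace (ρ.space 𝕜) := by
  refine NormedAddCommGroup.completeSpace_of_summable_imp_tendsto fun u hu => ?_
  have hum : ∀ i, Measurable fun ω => ‖(u i).1 ω‖ₑ := fun i => measurable_enorm _
  have htail : ∀ n, ρ (fun ω => ∑' i, ‖(u (i + n)).1 ω‖ₑ)
      ≤ ENNReal.ofReal (∑' i, ‖u (i + n)‖) := by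
    intro n
    refine (ρ.tsum_le _ fun i => hum _).trans (le_of_eq ?_)
    rw [ENNReal.ofReal_tsum_of_nonneg (fun _ => norm_nonneg _) ((summable_nat_add_iff n).2 hu)]
    exact tsum_congr fun i => (ofReal_norm_eq _).symm
  have hfin : ∀ᵐ ω ∂μ, ∑' i, ‖(u i).1 ω‖ₑ < ∞ := by
    refine ρ.ae_lt_top (Measurable.tsum hum) ?_
    exact (htail 0).trans_lt ENNReal.ofReal_lt_top
  have hsum : ∀ᵐ ω ∂μ, Summable fun i => ‖(u i).1 ω‖ := by
    filter_upwards [hfin] with ω h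
    have := ENNReal.summable_toReal h.ne
    simpa only [toReal_enorm] using this
  have hlim : ∀ᵐ ω ∂μ, Tendsto (fun n => (∑ i ∈ Finset.range n, u i).1 ω) atTop
      (𝓝 (∑' i, (u i).1 ω)) := by
    filter_upwards [hsum, ae_all_iff.2 fun n => coeFn_finset_sum (Finset.range n) u] with ω h1 h2
    simp only [h2]
    exact h1.of_norm.hasSum.tendsto_sum_nat
  have hmeas : AEStronglyMeasurable (fun ω => ∑' i, (u i).1 ω) μ :=
    aestronglyMeasurable_of_tendsto_ae atTop
      (fun n => (∑ i ∈ Finset.range n, u i).1.aestronglyMeasurable) hlim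
  set F : Ω →ₘ[μ] 𝕜 := AEEqFun.mk _ hmeas with hF
  have hFω : ∀ᵐ ω ∂μ, F ω = ∑' i, (u i).1 ω := AEEqFun.coeFn_mk _ hmeas
  have hdiff : ∀ n, ρ.gauge (F - (∑ i ∈ Finset.range n, u i).1)
      ≤ ENNReal.ofReal (∑' i, ‖u (i + n)‖) := by
    intro n
    refine le_trans (ρ.gauge_le (Measurable.tsum fun i => hum (i + n)) ?_) (htail n)
    filter_upwards [hFω, hsum, coeFn_finset_sum (Finset.range n) u,
      AEEqFun.coeFn_sub F (∑ i ∈ Finset.range n, u i).1] with ω h1 h2 h3 h4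
    rw [h4, Pi.sub_apply, h1, h3, ← h2.of_norm.sum_add_tsum_nat_add n, add_sub_cancel_left]
    exact enorm_tsum_le_tsum_enorm
  have hFmem : F ∈ ρ.space 𝕜 := by
    have := hdiff 0
    simp only [Finset.range_zero, Finset.sum_empty, Submodule.coe_zero, sub_zero] at this
    exact this.trans_lt ENNReal.ofReal_lt_top
  refine ⟨⟨F, hFmem⟩, ?_⟩
  rw [tendsto_iff_norm_sub_tendsto_zero]
  refine squeeze_zero (fun _ => norm_nonneg _) (fun n => ?_)
    (tendsto_sum_nat_add fun i => ‖u i‖)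
  rw [norm_sub_rev]
  exact ENNReal.toReal_le_of_le_ofReal (tsum_nonneg fun _ => norm_nonneg _) (hdiff n)

end space

/-! ### Convexity, concavity and estimates -/

/-- Lattice `r`-convexity, for `r < ∞`. -/
def LatticeConvex (ρ : FunctionNorm μ) (r : ℝ) : Prop :=
  ∃ C : ℝ≥0, ∀ (m : ℕ) (f : Fin m → Ω → ℝ≥0∞), (∀ i, Measurable (f i)) →
    ρ (fun ω => (∑ i, f i ω ^ r) ^ (1 / r)) ≤ C * (∑ i, ρ (f i) ^ r) ^ (1 / r)

/-- Lattice `r`-concavity, for `r < ∞`. -/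
def LatticeConcave (ρ : FunctionNorm μ) (r : ℝ) : Prop :=
  ∃ C : ℝ≥0, ∀ (m : ℕ) (f : Fin m → Ω → ℝ≥0∞), (∀ i, Measurable (f i)) →
    (∑ i, ρ (f i) ^ r) ^ (1 / r) ≤ C * ρ (fun ω => (∑ i, f i ω ^ r) ^ (1 / r))

/-- Nontrivial concavity: lattice `r`-concavity for some `r < ∞`. -/
def NontrivialConcavity (ρ : FunctionNorm μ) : Prop :=
  ∃ r : ℝ, 1 ≤ r ∧ ρ.LatticeConcave r

/-- Upper `r`-estimate, for `r < ∞`. -/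
def UpperEstimate (ρ : FunctionNorm μ) (r : ℝ) : Prop :=
  ∃ C : ℝ≥0, ∀ (m : ℕ) (f : Fin m → Ω → ℝ≥0∞), (∀ i, Measurable (f i)) →
    (Pairwise fun i j => Disjoint (Function.support (f i)) (Function.support (f j))) →
    ρ (fun ω => ∑ i, f i ω) ≤ C * (∑ i, ρ (f i) ^ r) ^ (1 / r)

/-- Lower `r`-estimate, for `r < ∞`. -/
def LowerEstimate (ρ : FunctionNorm μ) (r : ℝ) : Prop :=
  ∃ C : ℝ≥0, ∀ (m : ℕ) (f : Fin m → Ω → ℝ≥0∞), (∀ i, Measurable (f i)) →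
    (Pairwise fun i j => Disjoint (Function.support (f i)) (Function.support (f j))) →
    (∑ i, ρ (f i) ^ r) ^ (1 / r) ≤ C * ρ (fun ω => ∑ i, f i ω)

end FunctionNorm

/-! ### Sequences in Banach spaces -/

/-- Rademacher type `r`; the average runs over all choices of signs. -/
def HasRademacherType (X : Type*) [NormedAddCommGroup X] (r : ℝ) : Prop :=
  ∃ C : ℝ, ∀ (m : ℕ) (x : Fin m → X),
    (∑ ε : Fin m → ℤˣ, ‖∑ i, ε i • x i‖) / 2 ^ m ≤ C * (∑ i, ‖x i‖ ^ r) ^ (1 / r)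

section sequences

variable (𝕜 : Type*) [RCLike 𝕜] {X Y : Type*} [NormedAddCommGroup X] [NormedSpace 𝕜 X]
  [NormedAddCommGroup Y] [NormedSpace 𝕜 Y]

/-- `0 < inf ‖xₙ‖ ≤ sup ‖xₙ‖ < ∞`. -/
def SemiNormalized (x : ℕ → X) : Prop :=
  ∃ c C : ℝ, 0 < c ∧ ∀ n, c ≤ ‖x n‖ ∧ ‖x n‖ ≤ C

/-- The closed linear span `[xₙ : n ∈ ℕ]`. -/
abbrev closedSpan (x : ℕ → X) : Submodule 𝕜 X :=
  (Submodule.span 𝕜 (Set.range x)).topologicalClosure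

theorem mem_closedSpan (x : ℕ → X) (n : ℕ) : x n ∈ closedSpan 𝕜 x :=
  Submodule.le_topologicalClosure _ (Submodule.subset_span ⟨n, rfl⟩)

/-- An unconditional basic sequence is an unconditional basis of its closed linear span. -/
def IsUnconditionalBasicSequence (x : ℕ → X) : Prop :=
  ∃ b : UnconditionalSchauderBasis ℕ 𝕜 (closedSpan 𝕜 x), ∀ n, (b n : X) = x n

/-- `x` dominates `y`: some bounded linear map on `[xₙ : n ∈ ℕ]` takes `xₙ` to `yₙ` for all `n`. -/
def Dominates (x : ℕ → X) (y : ℕ → Y) : Prop :=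
  ∃ T : closedSpan 𝕜 x →L[𝕜] Y, ∀ n, T ⟨x n, mem_closedSpan 𝕜 x n⟩ = y n

/-- Equivalence of sequences. -/
def EquivalentSeq (x : ℕ → X) (y : ℕ → Y) : Prop :=
  Dominates 𝕜 x y ∧ Dominates 𝕜 y x

/-- The unit vector system of `ℓ₂`. -/
def unitVectors (n : ℕ) : lp (fun _ : ℕ => 𝕜) 2 := lp.single 2 n (1 : 𝕜)

end sequences

/-! ### Sequences of functions -/

section functions

variable {𝕜 : Type*} [RCLike 𝕜] {Ω : Type*} [MeasurableSpace Ω] {μ : Measure Ω}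

/-- The supports are pairwise disjoint, up to null sets. -/
def DisjointlySupported (f : ℕ → Ω →ₘ[μ] 𝕜) : Prop :=
  ∀ m n, m ≠ n → ∀ᵐ ω ∂μ, f m ω = 0 ∨ f n ω = 0

/-- `f` is (the class of) a measurable function taking finitely many values. -/
def IsSimple (f : Ω →ₘ[μ] 𝕜) : Prop :=
  ∃ s : SimpleFunc Ω 𝕜, f =ᵐ[μ] s

/-- `lim_n ess inf {|fₙ(ω)| : ω ∈ supp fₙ} = ∞`. -/
def EscapesToInfinity (f : ℕ → Ω →ₘ[μ] 𝕜) : Prop :=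
  Tendsto (fun n => essInf (fun ω => ‖f n ω‖ₑ) (μ.restrict (Function.support (f n))))
    atTop (𝓝 ∞)

end functions

end

/-! The argument is a Kadec–Pełczyński dichotomy for the `L₂` norms of the coordinates of `ψ n`.

Suppose first that, for some `c > 0`, every `ψ n` has a coordinate of `L₂` norm at least `c`. The
direct sum has type 2, which gives an upper `ℓ₂` estimate for one choice of signs; in `L₂` the
parallelogram law gives signs for the reverse estimate. Unconditionality removes the signs, so `ψ`
is equivalent to the unit vectors of `ℓ₂` (`equivalentSeq_unitVectors`).

Otherwise a subsequence tends to zero in `L₂` in every coordinate, hence almost everywhere after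
further extraction. Each `ρ j` is order continuous, because a lower estimate forbids infinitely many
disjoint pieces of norm at least `δ` under a function of finite norm; for the last space the lower
estimate comes from concavity. A gliding hump then makes each coordinate a summably small
perturbation of a disjointly supported simple sequence
(`OrderContinuous.exists_disjoint_simple_subsequence`).

It remains to discard all coordinates but one (`exists_coordinate_equivalentSeq`). Let `j₀` be the
first coordinate whose norms do not tend to zero. Earlier coordinates are perturbations of `0`. For
`j > j₀`, a lower `p`-estimate at `j₀` and an upper `q`-estimate at `j` with `p ≤ q` show that the
disjoint sequence at `j₀` dominates the one at `j`. Hence the whole subsequence is equivalent to its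
disjoint model at `j₀`. -/

noncomputable section

/-! ### Basic sequences -/

section basic

variable (𝕜 : Type*) [RCLike 𝕜] {X Y : Type*} [NormedAddCommGroup X] [NormedSpace 𝕜 X]
  [NormedAddCommGroup Y] [NormedSpace 𝕜 Y]

/-- Finitely supported linear combinations, as elements of the closed linear span. -/
def closedSpanCombination (x : ℕ → X) : (ℕ →₀ 𝕜) →ₗ[𝕜] closedSpan 𝕜 x :=
  Finsupp.linearCombination 𝕜 fun n => ⟨x n, mem_closedSpan 𝕜 x n⟩

theorem coe_closedSpanCombination (x : ℕ → X) (a : ℕ →₀ 𝕜) :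
    (closedSpanCombination 𝕜 x a : X) = ∑ i ∈ a.support, a i • x i := by
  simp [closedSpanCombination, Finsupp.linearCombination_apply, Finsupp.sum]

theorem closedSpanCombination_single (x : ℕ → X) (n : ℕ) :
    closedSpanCombination 𝕜 x (Finsupp.single n 1) = ⟨x n, mem_closedSpan 𝕜 x n⟩ := by
  simp [closedSpanCombination]

theorem denseRange_closedSpanCombination (x : ℕ → X) :
    DenseRange (closedSpanCombination 𝕜 x) := by
  refine Metric.denseRange_iff.2 fun v r hr => ?_
  obtain ⟨y, hy, hvy⟩ := Metric.mem_closure_iff.1 v.2 r hr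
  obtain ⟨a, rfl⟩ := (Finsupp.mem_span_range_iff_exists_finsupp).1 hy
  refine ⟨a, ?_⟩
  rw [Subtype.dist_eq, coe_closedSpanCombination]
  exact hvy

variable {𝕜}

theorem sum_range_eq_sum_support {Z : Type*} [AddCommGroup Z] [Module 𝕜 Z] (z : ℕ → Z)
    (a : ℕ →₀ 𝕜) :
    ∑ i ∈ Finset.range (a.support.sup id + 1), a i • z i = ∑ i ∈ a.support, a i • z i := by
  refine (Finset.sum_subset (fun i hi => ?_) fun i _ hi => ?_).symm
  · exact Finset.mem_range.2 (Nat.lt_succ_of_le (Finset.le_sup (f := id) hi))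
  · simp [Finsupp.notMem_support_iff.1 hi]

/-- Padding with zero coefficients turns any finite combination into one over an initial segment.
The map is thus bounded on a dense subspace and extends because `Y` is complete. -/
theorem dominates_of_norm_sum_le [CompleteSpace Y] {x : ℕ → X} {y : ℕ → Y} (C : ℝ)
    (h : ∀ (m : ℕ) (a : ℕ → 𝕜), ‖∑ i ∈ Finset.range m, a i • y i‖ ≤
      C * ‖∑ i ∈ Finset.range m, a i • x i‖) : Dominates 𝕜 x y := by
  have hb : ∃ C, ∀ a, ‖Finsupp.linearCombination 𝕜 y a‖ ≤ C * ‖closedSpanCombination 𝕜 x a‖ := by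
    refine ⟨C, fun a => ?_⟩
    have := h (a.support.sup id + 1) a
    rw [sum_range_eq_sum_support, sum_range_eq_sum_support] at this
    rw [Submodule.coe_norm, coe_closedSpanCombination, Finsupp.linearCombination_apply]
    exact this
  refine ⟨(Finsupp.linearCombination 𝕜 y).extendOfNorm (closedSpanCombination 𝕜 x), fun n => ?_⟩
  rw [← closedSpanCombination_single,
    LinearMap.extendOfNorm_eq (denseRange_closedSpanCombination 𝕜 x) hb]
  simp

theorem IsUnconditionalBasicSequence.exists_norm_sum_le [CompleteSpace X] {x : ℕ → X}
    (h : IsUnconditionalBasicSequence 𝕜 x) :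
    ∃ K : ℝ, 0 ≤ K ∧ ∀ (a : ℕ → 𝕜) (s t : Finset ℕ), s ⊆ t →
      ‖∑ i ∈ s, a i • x i‖ ≤ K * ‖∑ i ∈ t, a i • x i‖ := by
  obtain ⟨b, hb⟩ := h
  obtain ⟨K, hK⟩ := b.exists_norm_proj_le
  refine ⟨K, (norm_nonneg _).trans (hK ∅), fun a s t hst => ?_⟩
  have hcoe : ∀ u : Finset ℕ, ((∑ i ∈ u, a i • b i : closedSpan 𝕜 x) : X)
      = ∑ i ∈ u, a i • x i := by
    intro u
    rw [Submodule.coe_sum]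
    exact Finset.sum_congr rfl fun i _ => by rw [Submodule.coe_smul, hb]
  have hp : b.proj s (∑ i ∈ t, a i • b i) = ∑ i ∈ s, a i • b i := by
    simp only [map_sum, map_smul, b.proj_apply_basis_mem, smul_ite, smul_zero]
    rw [← Finset.sum_filter, Finset.filter_mem_eq_inter, Finset.inter_eq_right.2 hst]
  have := (b.proj s).le_of_opNorm_le (hK s) (∑ i ∈ t, a i • b i)
  rw [hp, Submodule.coe_norm, Submodule.coe_norm, hcoe, hcoe] at this
  exact this

/-- The hypothesis bounds coordinate functionals and truncations on finite combinations. By density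
these bounds pass to the closed span, and uniformly bounded truncations that converge on a dense set
converge everywhere. -/
theorem isUnconditionalBasicSequence_of_norm_sum_le {x : ℕ → X} (K : ℝ)
    (hx : ∀ n, x n ≠ 0)
    (h : ∀ (a : ℕ → 𝕜) (s t : Finset ℕ), s ⊆ t →
      ‖∑ i ∈ s, a i • x i‖ ≤ K * ‖∑ i ∈ t, a i • x i‖) :
    IsUnconditionalBasicSequence 𝕜 x := by
  classical
  set e := closedSpanCombination 𝕜 x with he
  have hd : DenseRange e := denseRange_closedSpanCombination 𝕜 x
  have hK : 0 ≤ K := by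
    have := h (fun _ => 1) {0} {0} subset_rfl
    simp only [Finset.sum_singleton, one_smul] at this
    have h0 := norm_pos_iff.2 (hx 0)
    by_contra hneg
    nlinarith
  have hsub : ∀ (s : Finset ℕ) (a : ℕ →₀ 𝕜), ‖∑ i ∈ s, a i • x i‖ ≤ K * ‖e a‖ := by
    intro s a
    rw [Submodule.coe_norm, he, coe_closedSpanCombination]
    refine le_trans (le_of_eq ?_) (h a (s ∩ a.support) a.support Finset.inter_subset_right)
    congr 1
    refine (Finset.sum_subset Finset.inter_subset_left fun i hi hi' => ?_).symm
    have : a i = 0 := by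
      by_contra h0
      exact hi' (Finset.mem_inter.2 ⟨hi, Finsupp.mem_support_iff.2 h0⟩)
    simp [this]
  have hcb : ∀ n, ∃ C, ∀ a, ‖Finsupp.lapply (R := 𝕜) (M := 𝕜) n a‖ ≤ C * ‖e a‖ := by
    intro n
    refine ⟨K / ‖x n‖, fun a => ?_⟩
    have := hsub {n} a
    rw [Finset.sum_singleton, norm_smul] at this
    rw [Finsupp.lapply_apply, div_mul_eq_mul_div, le_div_iff₀ (norm_pos_iff.2 (hx n))]
    exact this
  let f : ℕ → StrongDual 𝕜 (closedSpan 𝕜 x) := fun n =>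
    (Finsupp.lapply (R := 𝕜) (M := 𝕜) n).extendOfNorm e
  have hf : ∀ n a, f n (e a) = a n := fun n a => LinearMap.extendOfNorm_eq hd (hcb n) a
  let b : ℕ → closedSpan 𝕜 x := fun n => ⟨x n, mem_closedSpan 𝕜 x n⟩
  have hbe : ∀ n, b n = e (Finsupp.single n 1) := fun n => (closedSpanCombination_single 𝕜 x n).symm
  have hcoe : ∀ (s : Finset ℕ) (a : ℕ → 𝕜), ((∑ i ∈ s, a i • b i : closedSpan 𝕜 x) : X)
      = ∑ i ∈ s, a i • x i := by
    intro s a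
    rw [Submodule.coe_sum]
    rfl
  have hP : ∀ (s : Finset ℕ) (v : closedSpan 𝕜 x), ‖∑ i ∈ s, f i v • b i‖ ≤ K * ‖v‖ := by
    intro s v
    induction v using hd.induction_on with
    | hp => exact isClosed_le (by fun_prop) (by fun_prop)
    | ih a =>
      simp only [hf]
      rw [Submodule.coe_norm, hcoe]
      exact hsub s a
  refine ⟨⟨b, f, fun i j => ?_, fun v => ?_⟩, fun n => rfl⟩
  · rw [hbe, hf, Finsupp.single_eq_pi_single]
    by_cases hij : i = j <;> simp [hij]
  · rw [HasSum, SummationFilter.unconditional_filter, Metric.tendsto_atTop]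
    intro r hr
    -- The error `v - e a` is counted once itself and once truncated, at cost `K`; hence the factor
    -- `K + 1`.
    obtain ⟨a, ha⟩ := Metric.denseRange_iff.1 hd v (r / (K + 1)) (by positivity)
    refine ⟨a.support, fun s hs => ?_⟩
    have h1 : ∑ i ∈ s, f i (e a) • b i = e a := by
      apply Subtype.ext
      simp only [hf]
      rw [hcoe, he, coe_closedSpanCombination]
      refine (Finset.sum_subset hs fun i _ hi => ?_).symm
      simp [Finsupp.notMem_support_iff.1 hi]
    have h2 : (∑ i ∈ s, f i v • b i) - v = (∑ i ∈ s, f i (v - e a) • b i) - (v - e a) := by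
      simp only [map_sub, sub_smul, Finset.sum_sub_distrib, h1]
      abel
    rw [dist_eq_norm, h2]
    rw [dist_eq_norm] at ha
    calc _ ≤ ‖∑ i ∈ s, f i (v - e a) • b i‖ + ‖v - e a‖ := norm_sub_le _ _
      _ ≤ K * ‖v - e a‖ + ‖v - e a‖ := by gcongr; exact hP s _
      _ = (K + 1) * ‖v - e a‖ := by ring
      _ < (K + 1) * (r / (K + 1)) := by gcongr
      _ = r := by field_simp

/-- The signed sum is a difference of two subsums, each costing one factor `K`. -/
theorem norm_sum_units_smul_le {x : ℕ → X} {K : ℝ}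
    (h : ∀ (a : ℕ → 𝕜) (s t : Finset ℕ), s ⊆ t →
      ‖∑ i ∈ s, a i • x i‖ ≤ K * ‖∑ i ∈ t, a i • x i‖)
    (ε : ℕ → ℤˣ) (a : ℕ → 𝕜) (s : Finset ℕ) :
    ‖∑ i ∈ s, ε i • a i • x i‖ ≤ 2 * K * ‖∑ i ∈ s, a i • x i‖ := by
  classical
  have h1 : ∑ i ∈ s, ε i • a i • x i =
      ∑ i ∈ s with ε i = 1, a i • x i - ∑ i ∈ s with ¬ ε i = 1, a i • x i := by
    rw [← Finset.sum_filter_add_sum_filter_not s (fun i => ε i = 1), sub_eq_add_neg,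
      ← Finset.sum_neg_distrib]
    congr 1
    · refine Finset.sum_congr rfl fun i hi => ?_
      rw [(Finset.mem_filter.1 hi).2, one_smul]
    · refine Finset.sum_congr rfl fun i hi => ?_
      rw [(Int.units_eq_one_or (ε i)).resolve_left (Finset.mem_filter.1 hi).2]
      simp
  rw [h1]
  calc _ ≤ ‖∑ i ∈ s with ε i = 1, a i • x i‖ + ‖∑ i ∈ s with ¬ ε i = 1, a i • x i‖ :=
        norm_sub_le _ _
    _ ≤ K * ‖∑ i ∈ s, a i • x i‖ + K * ‖∑ i ∈ s, a i • x i‖ :=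
        add_le_add (h a _ _ (Finset.filter_subset _ _)) (h a _ _ (Finset.filter_subset _ _))
    _ = _ := by ring

theorem norm_sum_le_norm_sum_units_smul {x : ℕ → X} {K : ℝ}
    (h : ∀ (a : ℕ → 𝕜) (s t : Finset ℕ), s ⊆ t →
      ‖∑ i ∈ s, a i • x i‖ ≤ K * ‖∑ i ∈ t, a i • x i‖)
    (ε : ℕ → ℤˣ) (a : ℕ → 𝕜) (s : Finset ℕ) :
    ‖∑ i ∈ s, a i • x i‖ ≤ 2 * K * ‖∑ i ∈ s, ε i • a i • x i‖ := by
  have hsm : ∀ i, ε i • a i • x i = (ε i • a i) • x i := fun i => (smul_assoc _ _ _).symm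
  have := norm_sum_units_smul_le h ε (fun i => ε i • a i) s
  simp only [hsm]
  have h2 : ∀ i, ε i • (ε i • a i) • x i = a i • x i := fun i => by
    rw [← smul_assoc, smul_smul, Int.units_mul_self, one_smul]
  simpa only [h2] using this

end basic

/-! ### Random signs -/

section signs

/-- Some choice of signs does at least as well as the average. For unconditional sequences one good
choice is enough. -/
theorem HasRademacherType.exists_signs {X : Type*} [NormedAddCommGroup X]
    (h : HasRademacherType X 2) :
    ∃ C : ℝ, 0 ≤ C ∧ ∀ (m : ℕ) (x : ℕ → X), ∃ ε : ℕ → ℤˣ,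
      ‖∑ i ∈ Finset.range m, ε i • x i‖ ≤ C * √(∑ i ∈ Finset.range m, ‖x i‖ ^ 2) := by
  obtain ⟨C, hC⟩ := h
  refine ⟨max C 0, le_max_right _ _, fun m x => ?_⟩
  set R := max C 0 * √(∑ i ∈ Finset.range m, ‖x i‖ ^ 2)
  have h1 : (∑ ε : Fin m → ℤˣ, ‖∑ i, ε i • x i‖) / 2 ^ m ≤ R := by
    refine (hC m fun i => x i).trans ?_
    rw [← Real.sqrt_eq_rpow]
    simp only [Real.rpow_two, R, Finset.sum_range]
    gcongr
    exact le_max_left _ _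
  have hcard : (Finset.univ : Finset (Fin m → ℤˣ)).card = 2 ^ m := by simp
  obtain ⟨ε, -, hε⟩ : ∃ ε ∈ (Finset.univ : Finset (Fin m → ℤˣ)), ‖∑ i, ε i • x i‖ ≤ R := by
    refine Finset.exists_le_of_sum_le Finset.univ_nonempty ?_
    rw [Finset.sum_const, hcard, nsmul_eq_mul, Nat.cast_pow, Nat.cast_ofNat]
    rwa [div_le_iff₀' (by positivity)] at h1
  refine ⟨fun i => if hi : i < m then ε ⟨i, hi⟩ else 1, ?_⟩
  rw [Finset.sum_range]
  simpa using hε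

theorem HasRademacherType.pi {ι : Type*} [Fintype ι] {X : ι → Type*}
    [∀ j, NormedAddCommGroup (X j)] (h : ∀ j, HasRademacherType (X j) 2) :
    HasRademacherType (∀ j, X j) 2 := by
  choose C hC using h
  refine ⟨∑ j, |C j|, fun m x => ?_⟩
  have hnorm : ∀ y : ∀ j, X j, ‖y‖ ≤ ∑ j, ‖y j‖ := fun y =>
    (pi_norm_le_iff_of_nonneg (by positivity)).2 fun j =>
      Finset.single_le_sum (f := fun j => ‖y j‖) (fun _ _ => norm_nonneg _) (Finset.mem_univ j)
  calc (∑ ε : Fin m → ℤˣ, ‖∑ i, ε i • x i‖) / 2 ^ m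
      ≤ (∑ ε : Fin m → ℤˣ, ∑ j, ‖(∑ i, ε i • x i) j‖) / 2 ^ m := by
        gcongr
        exact hnorm _
    _ = ∑ j, (∑ ε : Fin m → ℤˣ, ‖∑ i, ε i • x i j‖) / 2 ^ m := by
        rw [Finset.sum_comm, Finset.sum_div]
        simp only [Finset.sum_apply, Pi.smul_apply]
    _ ≤ ∑ j, |C j| * (∑ i, ‖x i‖ ^ (2 : ℝ)) ^ (1 / 2 : ℝ) := by
        refine Finset.sum_le_sum fun j _ => (hC j m fun i => x i j).trans ?_
        gcongr with i
        · exact le_abs_self _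
        · exact norm_le_pi_norm _ _
    _ = _ := by rw [Finset.sum_mul]

/-- By the parallelogram law one of `‖S ± x‖ ^ 2` is at least `‖S‖ ^ 2 + ‖x‖ ^ 2`, so the signs can
be chosen greedily. -/
theorem exists_signs_sum_sq_le {𝕜 H : Type*} [RCLike 𝕜] [NormedAddCommGroup H]
    [InnerProductSpace 𝕜 H] (x : ℕ → H) (m : ℕ) :
    ∃ ε : ℕ → ℤˣ, ∑ i ∈ Finset.range m, ‖x i‖ ^ 2 ≤ ‖∑ i ∈ Finset.range m, ε i • x i‖ ^ 2 := by
  induction m with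
  | zero => exact ⟨1, by simp⟩
  | succ m ih =>
    obtain ⟨ε, hε⟩ := ih
    set S := ∑ i ∈ Finset.range m, ε i • x i with hS
    have hpar := parallelogram_law_with_norm 𝕜 S (x m)
    have key : ∃ η : ℤˣ, ‖S‖ ^ 2 + ‖x m‖ ^ 2 ≤ ‖S + η • x m‖ ^ 2 := by
      by_cases h1 : ‖S‖ ^ 2 + ‖x m‖ ^ 2 ≤ ‖S + x m‖ ^ 2
      · exact ⟨1, by simpa using h1⟩
      · refine ⟨-1, ?_⟩
        have : S + (-1 : ℤˣ) • x m = S - x m := by simp [sub_eq_add_neg]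
        rw [this]
        nlinarith
    obtain ⟨η, hη⟩ := key
    refine ⟨Function.update ε m η, ?_⟩
    rw [Finset.sum_range_succ, Finset.sum_range_succ, Function.update_self]
    have : ∑ i ∈ Finset.range m, Function.update ε m η i • x i = S := by
      refine Finset.sum_congr rfl fun i hi => ?_
      rw [Function.update_of_ne (Finset.mem_range.1 hi).ne]
    rw [this]
    linarith

end signs

namespace FunctionNorm

variable {Ω : Type*} [MeasurableSpace Ω] {μ : Measure Ω}

/-! ### Order continuity -/

/-- The norm of a fixed function is order continuous along decreasing sequences of sets. -/
def OrderContinuous (ρ : FunctionNorm μ) : Prop :=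
  ∀ f : Ω → ℝ≥0∞, Measurable f → ρ f < ∞ → ∀ A : ℕ → Set Ω, (∀ n, MeasurableSet (A n)) →
    Antitone A → (∀ᵐ ω ∂μ, ∃ n, ω ∉ A n) → Tendsto (fun n => ρ ((A n).indicator f)) atTop (𝓝 0)

variable {ρ : FunctionNorm μ}

theorem zero_eq (ρ : FunctionNorm μ) : ρ (fun _ => 0) = 0 :=
  (ρ.eq_zero_iff _ measurable_const).2 (Eventually.of_forall fun _ => rfl)

theorem mono_of_le (ρ : FunctionNorm μ) {f g : Ω → ℝ≥0∞} (hf : Measurable f) (hg : Measurable g)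
    (h : ∀ ω, f ω ≤ g ω) : ρ f ≤ ρ g :=
  ρ.mono f g hf hg (Eventually.of_forall h)

/-- Up to a null set, `A k \ A m` increases to `A k` as `m` grows, so the monotone continuity of `ρ`
applies. -/
theorem exists_lt_indicator_diff {f : Ω → ℝ≥0∞} (hf : Measurable f) {A : ℕ → Set Ω}
    (hA : ∀ n, MeasurableSet (A n)) (hanti : Antitone A) (hnull : ∀ᵐ ω ∂μ, ∃ n, ω ∉ A n)
    {δ : ℝ≥0∞} {k : ℕ} (hδ : δ < ρ ((A k).indicator f)) :
    ∃ m, k < m ∧ δ < ρ ((A k \ A m).indicator f) := by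
  have hmeas : ∀ m, Measurable ((A k \ A m).indicator f) := fun m =>
    hf.indicator ((hA k).diff (hA m))
  have hmono : Monotone fun m => (A k \ A m).indicator f := fun m n hmn ω =>
    Set.indicator_le_indicator_of_subset (Set.sdiff_subset_sdiff_right (hanti hmn))
      (fun _ => zero_le) ω
  have hsup : ρ ((A k).indicator f) = ⨆ m, ρ ((A k \ A m).indicator f) := by
    rw [← ρ.iSup_eq _ hmeas hmono]
    refine ρ.congr_ae (hf.indicator (hA k)) (Measurable.iSup hmeas) ?_
    filter_upwards [hnull] with ω ⟨n, hn⟩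
    refine le_antisymm ?_ (iSup_le fun m =>
      Set.indicator_le_indicator_of_subset Set.sdiff_subset (fun _ => zero_le) ω)
    refine le_trans (le_of_eq ?_) (le_iSup _ n)
    by_cases hk : ω ∈ A k <;> simp [hk, hn]
  rw [hsup, lt_iSup_iff] at hδ
  obtain ⟨m, hm⟩ := hδ
  refine ⟨m, ?_, hm⟩
  by_contra hle
  rw [Set.sdiff_eq_empty.2 (hanti (not_lt.1 hle)), Set.indicator_empty] at hm
  exact absurd hm (by rw [ρ.zero_eq]; simp)

/-- If the norms stay above some `δ > 0`, then infinitely many disjoint differences `A (κ n) \ A (κ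
(n + 1))` carry a part of `f` of norm above `δ`. The lower estimate for `m` of them gives `m * δ ^ r
≤ (C * ρ f) ^ r`, which fails for large `m`. -/
theorem LowerEstimate.orderContinuous {r : ℝ} (hr : 0 < r) (h : ρ.LowerEstimate r) :
    ρ.OrderContinuous := by
  intro f hf hρf A hA hanti hnull
  obtain ⟨C, hC⟩ := h
  have hantiρ : Antitone fun n => ρ ((A n).indicator f) := fun m n hmn =>
    ρ.mono_of_le (hf.indicator (hA n)) (hf.indicator (hA m)) fun ω =>
      Set.indicator_le_indicator_of_subset (hanti hmn) (fun _ => zero_le) ω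
  have hlim := tendsto_atTop_iInf hantiρ
  by_contra hnot
  have hne : 0 < ⨅ n, ρ ((A n).indicator f) := by
    rw [pos_iff_ne_zero]
    intro h0
    rw [h0] at hlim
    exact hnot hlim
  obtain ⟨δ, hδ0, hδ⟩ := exists_between hne
  have hδk : ∀ k, δ < ρ ((A k).indicator f) := fun k => hδ.trans_le (iInf_le _ k)
  choose next hnext_lt hnext using fun k => exists_lt_indicator_diff hf hA hanti hnull (hδk k)
  let κ : ℕ → ℕ := fun n => next^[n] 0
  have hκ_succ : ∀ n, κ (n + 1) = next (κ n) := fun n => Function.iterate_succ_apply' _ _ _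
  have hκ_mono : StrictMono κ := strictMono_nat_of_lt_succ fun n => by
    rw [hκ_succ]; exact hnext_lt _
  let D : ℕ → Set Ω := fun n => A (κ n) \ A (κ (n + 1))
  have hDm : ∀ n, MeasurableSet (D n) := fun n => (hA _).diff (hA _)
  have hDlt : ∀ i j, i < j → Disjoint (D i) (D j) := fun i j hij =>
    Set.disjoint_left.2 fun ω h1 h2 => h1.2 (hanti (hκ_mono.monotone hij) h2.1)
  have hD : ∀ i j, i ≠ j → Disjoint (D i) (D j) := fun i j hij =>
    hij.lt_or_gt.elim (hDlt i j) fun h => (hDlt j i h).symm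
  have hbound : ∀ m : ℕ, (m : ℝ≥0∞) * δ ^ r ≤ (C * ρ f) ^ r := by
    intro m
    have h1 := hC m (fun i => (D i).indicator f) (fun i => hf.indicator (hDm i))
      (fun i j hij => (hD i j fun h => hij (Fin.ext h)).mono Set.support_indicator_subset
        Set.support_indicator_subset)
    have h2 : ρ (fun ω => ∑ i : Fin m, (D i).indicator f ω) ≤ ρ f := by
      refine ρ.mono_of_le (Finset.measurable_fun_sum _ fun i _ => hf.indicator (hDm i)) hf
        fun ω => ?_
      by_cases hex : ∃ i : Fin m, ω ∈ D i
      · obtain ⟨i, hi⟩ := hex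
        rw [Finset.sum_eq_single i]
        · exact Set.indicator_le_self _ _ _
        · intro j _ hji
          exact Set.indicator_of_notMem
            (fun hj => Set.disjoint_left.1 (hD j i fun h => hji (Fin.ext h)) hj hi) _
        · simp
      · push Not at hex
        simp [hex]
    have h3 : (∑ _i : Fin m, δ ^ r) ≤ ∑ i : Fin m, ρ ((D i).indicator f) ^ r := by
      refine Finset.sum_le_sum fun i _ => ENNReal.rpow_le_rpow ?_ hr.le
      have := hnext (κ i)
      rw [← hκ_succ] at this
      exact this.le
    rw [Finset.sum_const, Finset.card_univ, Fintype.card_fin, nsmul_eq_mul] at h3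
    refine h3.trans ?_
    rw [← ENNReal.rpow_inv_le_iff hr, inv_eq_one_div]
    exact h1.trans (by gcongr)
  have hfin : (C * ρ f) ^ r / δ ^ r < ∞ := by
    refine ENNReal.div_lt_top (ENNReal.rpow_ne_top_of_nonneg hr.le
      (ENNReal.mul_ne_top ENNReal.coe_ne_top hρf.ne)) ?_
    exact (ENNReal.rpow_pos hδ0 (hδ.trans_le le_top).ne).ne'
  obtain ⟨m, hm⟩ := ENNReal.exists_nat_gt hfin.ne
  refine absurd hm (not_lt.2 ?_)
  rw [ENNReal.le_div_iff_mul_le]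
  · exact hbound m
  · exact Or.inl (ENNReal.rpow_pos hδ0 (hδ.trans_le le_top).ne).ne'
  · exact Or.inl (ENNReal.rpow_ne_top_of_nonneg hr.le (hδ.trans_le le_top).ne)

/-- Dominated convergence. Let `A n` be the set where `h m > η F` for some `m ≥ n`; these sets
decrease to a null set. Off `A n` the function `h n` is at most `η F`, and on `A n` it is at most
`F`, whose part there has small norm. -/
theorem OrderContinuous.tendsto_zero (hρ : ρ.OrderContinuous) {F : Ω → ℝ≥0∞} (hF : Measurable F)
    (hρF : ρ F < ∞) {h : ℕ → Ω → ℝ≥0∞} (hh : ∀ n, Measurable (h n))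
    (hle : ∀ n, ∀ᵐ ω ∂μ, h n ω ≤ F ω)
    (hlim : ∀ᵐ ω ∂μ, Tendsto (fun n => h n ω) atTop (𝓝 0)) :
    Tendsto (fun n => ρ (h n)) atTop (𝓝 0) := by
  rw [ENNReal.tendsto_atTop_zero]
  intro ε hε
  obtain ⟨η, hη0, hη⟩ : ∃ η : ℝ≥0, 0 < η ∧ η * ρ F < ε / 2 := by
    obtain ⟨η, hη0, hη⟩ := ENNReal.exists_nnreal_pos_mul_lt hρF.ne (ENNReal.half_pos hε.ne').ne'
    exact ⟨η, hη0, hη⟩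
  let A : ℕ → Set Ω := fun n => ⋃ m ≥ n, {ω | η * F ω < h m ω}
  have hA : ∀ n, MeasurableSet (A n) := fun n => MeasurableSet.iUnion fun m =>
    MeasurableSet.iUnion fun _ => measurableSet_lt (hF.const_mul _) (hh m)
  have hanti : Antitone A := fun m n hmn =>
    Set.iUnion_mono fun i => Set.iUnion_mono' fun hi => ⟨hmn.trans hi, subset_rfl⟩
  have hnull : ∀ᵐ ω ∂μ, ∃ n, ω ∉ A n := by
    filter_upwards [hlim, ae_all_iff.2 hle] with ω h1 h2
    have h3 : ∀ᶠ m in atTop, h m ω ≤ η * F ω := by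
      rcases eq_or_ne (F ω) 0 with h0 | h0
      · refine Eventually.of_forall fun m => ?_
        rw [h0, mul_zero]
        exact (h2 m).trans h0.le
      · have : 0 < η * F ω := ENNReal.mul_pos (by exact_mod_cast hη0.ne') h0
        filter_upwards [h1.eventually (gt_mem_nhds this)] with m hm using hm.le
    obtain ⟨n, hn⟩ := eventually_atTop.1 h3
    refine ⟨n, ?_⟩
    simp only [A, Set.mem_iUnion, Set.mem_ofPred_eq, not_exists, not_lt]
    exact fun m hm => hn m hm
  obtain ⟨N, hN⟩ := ENNReal.tendsto_atTop_zero.1 (hρ F hF hρF A hA hanti hnull) (ε / 2)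
    (ENNReal.half_pos hε.ne')
  refine ⟨N, fun n hn => ?_⟩
  have hm1 : Measurable fun ω => η * F ω := hF.const_mul _
  have hm2 : Measurable ((A n).indicator F) := hF.indicator (hA n)
  calc ρ (h n) ≤ ρ (fun ω => η * F ω + (A n).indicator F ω) := by
        refine ρ.mono _ _ (hh n) (hm1.add hm2) ?_
        filter_upwards [hle n] with ω h1
        by_cases hω : ω ∈ A n
        · rw [Set.indicator_of_mem hω]
          exact h1.trans le_add_self
        · rw [Set.indicator_of_notMem hω, add_zero]
          simp only [A, Set.mem_iUnion, Set.mem_ofPred_eq, not_exists, not_lt] at hω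
          exact hω n le_rfl
    _ ≤ ρ (fun ω => η * F ω) + ρ ((A n).indicator F) := ρ.add_le _ _ hm1 hm2
    _ ≤ ε / 2 + ε / 2 := by
        rw [ρ.const_mul _ _ hF]
        exact add_le_add hη.le (hN n hn)
    _ = ε := ENNReal.add_halves ε

/-- For disjoint supports at most one term is nonzero at each point, so the `ℓ_r` sum is the plain
sum. -/
theorem LatticeConcave.lowerEstimate {r : ℝ} (hr : 1 ≤ r) (h : ρ.LatticeConcave r) :
    ρ.LowerEstimate r := by
  obtain ⟨C, hC⟩ := h
  refine ⟨C, fun m f hf hd => (hC m f hf).trans (le_of_eq ?_)⟩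
  congr 2
  funext ω
  have hr0 : 0 < r := by linarith
  by_cases hex : ∃ i, f i ω ≠ 0
  · obtain ⟨i, hi⟩ := hex
    have hz : ∀ j, j ≠ i → f j ω = 0 := fun j hj => by
      by_contra h0
      exact Set.disjoint_left.1 (hd hj) h0 hi
    rw [Finset.sum_eq_single i (fun j _ hj => hz j hj) (by simp),
      Finset.sum_eq_single i (fun j _ hj => by rw [hz j hj, ENNReal.zero_rpow_of_pos hr0])
        (by simp), ← ENNReal.rpow_mul, mul_one_div_cancel hr0.ne', ENNReal.rpow_one]
  · push Not at hex
    simp [hex, ENNReal.zero_rpow_of_pos hr0, hr0]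

/-- A strictly positive function of finite norm, which is constant if the measure is finite. -/
theorem exists_weight [SigmaFinite μ] (ρ : FunctionNorm μ) :
    ∃ w : Ω → ℝ≥0∞, Measurable w ∧ (∀ ω, 0 < w ω) ∧ ρ w < ∞ ∧
      (μ Set.univ < ∞ → w = fun _ => 1) := by
  by_cases hfin : μ Set.univ < ∞
  · refine ⟨fun _ => 1, measurable_const, fun _ => zero_lt_one, ?_, fun _ => rfl⟩
    have := ρ.indicator_lt_top Set.univ MeasurableSet.univ hfin
    rwa [Set.indicator_univ] at this
  · let u : ℕ → Ω → ℝ≥0∞ := fun n => (spanningSets μ n).indicator fun _ => 1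
    have hu : ∀ n, Measurable (u n) := fun n =>
      measurable_const.indicator (measurableSet_spanningSets μ n)
    obtain ⟨δ, hδ, hsum⟩ := ENNReal.exists_pos_tsum_mul_lt_of_countable (ε := 1) one_ne_zero
      (fun n => ρ (u n)) fun n => (ρ.indicator_lt_top _ (measurableSet_spanningSets μ n)
        (measure_spanningSets_lt_top μ n)).ne
    refine ⟨fun ω => ∑' n, δ n * u n ω, Measurable.tsum fun n => (hu n).const_mul _,
      fun ω => ?_, ?_, fun h => absurd h hfin⟩
    · refine lt_of_lt_of_le ?_ (ENNReal.le_tsum (spanningSetsIndex μ ω))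
      have : u (spanningSetsIndex μ ω) ω = 1 :=
        Set.indicator_of_mem (mem_spanningSetsIndex μ ω) _
      rw [this, mul_one]
      exact_mod_cast hδ _
    · refine (ρ.tsum_le (fun n ω => δ n * u n ω) fun n => (hu n).const_mul _).trans_lt ?_
      refine lt_of_le_of_lt (le_of_eq ?_) (hsum.trans ENNReal.one_lt_top)
      refine tsum_congr fun n => ?_
      rw [ρ.const_mul _ _ (hu n), mul_comm]

/-! ### Inclusion in `L₂` -/

section inclusion

variable {𝕜 : Type*} [RCLike 𝕜]

theorem eLpNorm_two_eq {E : Type*} [NormedAddCommGroup E] (f : Ω → E) :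
    eLpNorm f 2 μ = (∫⁻ ω, ‖f ω‖ₑ ^ (2 : ℝ) ∂μ) ^ (1 / (2 : ℝ)) := by
  rw [eLpNorm_eq_lintegral_rpow_enorm_toReal two_ne_zero ENNReal.ofNat_ne_top]
  simp

theorem lintegral_sq_lt_top (hL2 : (ρ.space 𝕜).toAddSubgroup ≤ Lp 𝕜 2 μ) {g : Ω → ℝ≥0∞}
    (hg : Measurable g) (hρ : ρ g < ∞) : ∫⁻ ω, g ω ^ (2 : ℝ) ∂μ < ∞ := by
  have hG : Measurable fun ω => (((g ω).toReal : ℝ) : 𝕜) :=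
    RCLike.measurable_ofReal.comp hg.ennreal_toReal
  set G : Ω →ₘ[μ] 𝕜 := AEEqFun.mk _ hG.aestronglyMeasurable with hGdef
  have hGg : ∀ᵐ ω ∂μ, ‖G ω‖ₑ = g ω := by
    filter_upwards [AEEqFun.coeFn_mk _ hG.aestronglyMeasurable, ρ.ae_lt_top hg hρ] with ω h1 h2
    rw [hGdef, h1, ← ofReal_norm, RCLike.norm_ofReal, abs_of_nonneg ENNReal.toReal_nonneg,
      ENNReal.ofReal_toReal h2.ne]
  have hmem : G ∈ ρ.space 𝕜 := (ρ.gauge_le hg (hGg.mono fun ω h => h.le)).trans_lt hρ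
  have := Lp.mem_Lp_iff_eLpNorm_lt_top.1 (hL2 hmem)
  rw [eLpNorm_two_eq, ENNReal.rpow_lt_top_iff_of_pos (by norm_num)] at this
  rwa [lintegral_congr_ae (hGg.mono fun ω h => by rw [h])] at this

/-- If no bound exists, a normalized series of bad functions with weights `2⁻¹ ^ n` has finite `ρ`,
hence lies in `L₂`, while its `L₂` norm is at least `n` for every `n`. -/
theorem exists_eLpNorm_le (hL2 : (ρ.space 𝕜).toAddSubgroup ≤ Lp 𝕜 2 μ) :
    ∃ B : ℝ≥0, ∀ f : ρ.space 𝕜, eLpNorm f.1 2 μ ≤ B * ρ.gauge f.1 := by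
  by_contra! hcon
  -- The factor `2 ^ n` cancels the weight of the `n`-th term, leaving `n`.
  choose f hf using fun n : ℕ => hcon (2 ^ n * n)
  have hq0 : ∀ n, ρ.gauge (f n).1 ≠ 0 := by
    intro n h0
    have hz := ρ.gauge_eq_zero.1 h0
    have := hf n
    rw [h0, hz, eLpNorm_congr_ae AEEqFun.coeFn_zero] at this
    simp at this
  let c : ℕ → ℝ≥0∞ := fun n => 2⁻¹ ^ n * (ρ.gauge (f n).1)⁻¹
  have hm : ∀ n, Measurable fun ω => c n * ‖(f n).1 ω‖ₑ := fun n =>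
    (measurable_enorm _).const_mul _
  have hρg : ρ (fun ω => ∑' n, c n * ‖(f n).1 ω‖ₑ) < ∞ := by
    refine (ρ.tsum_le (fun n ω => c n * ‖(f n).1 ω‖ₑ) hm).trans_lt ?_
    have : ∀ n, ρ (fun ω => c n * ‖(f n).1 ω‖ₑ) = 2⁻¹ ^ n := fun n => by
      rw [ρ.const_mul _ _ (measurable_enorm _)]
      change 2⁻¹ ^ n * (ρ.gauge (f n).1)⁻¹ * ρ.gauge (f n).1 = _
      rw [mul_assoc, ENNReal.inv_mul_cancel (hq0 n) (gauge_ne_top _), mul_one]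
    simp only [this, ENNReal.tsum_geometric]
    rw [ENNReal.one_sub_inv_two, inv_inv]
    exact ENNReal.ofNat_lt_top
  have hT := lintegral_sq_lt_top hL2 (Measurable.tsum hm) hρg
  obtain ⟨n, hn⟩ := ENNReal.exists_nat_gt
    (ENNReal.rpow_lt_top_of_nonneg (y := 1 / (2 : ℝ)) (by norm_num) hT.ne).ne
  refine absurd hn (not_lt.2 ?_)
  have h1 : c n * eLpNorm (f n).1 2 μ ≤
      (∫⁻ ω, (∑' n, c n * ‖(f n).1 ω‖ₑ) ^ (2 : ℝ) ∂μ) ^ (1 / (2 : ℝ)) := by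
    rw [eLpNorm_two_eq]
    calc c n * (∫⁻ ω, ‖(f n).1 ω‖ₑ ^ (2 : ℝ) ∂μ) ^ (1 / (2 : ℝ))
        = (∫⁻ ω, (c n * ‖(f n).1 ω‖ₑ) ^ (2 : ℝ) ∂μ) ^ (1 / (2 : ℝ)) := by
          simp only [ENNReal.mul_rpow_of_nonneg _ _ (zero_le_two (α := ℝ))]
          rw [lintegral_const_mul _ ((measurable_enorm _).pow_const _),
            ENNReal.mul_rpow_of_nonneg _ _ (by norm_num), ← ENNReal.rpow_mul]
          norm_num
      _ ≤ _ := by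
          gcongr with ω
          exact ENNReal.le_tsum (f := fun n => c n * ‖(f n).1 ω‖ₑ) n
  refine le_trans ?_ h1
  calc (n : ℝ≥0∞) = c n * (((2 ^ n * n : ℝ≥0) : ℝ≥0∞) * ρ.gauge (f n).1) := by
        have e1 : (2⁻¹ : ℝ≥0∞) ^ n * 2 ^ n = 1 := by
          rw [← mul_pow, ENNReal.inv_mul_cancel two_ne_zero ENNReal.ofNat_ne_top, one_pow]
        have e2 := ENNReal.inv_mul_cancel (hq0 n) (gauge_ne_top _)
        push_cast
        calc (n : ℝ≥0∞) = (2⁻¹ ^ n * 2 ^ n) * ((ρ.gauge (f n).1)⁻¹ * ρ.gauge (f n).1) * n := by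
              rw [e1, e2]; simp
          _ = _ := by simp only [c]; ring
    _ ≤ _ := by gcongr; exact (hf n).le

end inclusion

end FunctionNorm

namespace FunctionNorm

variable {Ω : Type*} [MeasurableSpace Ω] {μ : Measure Ω} {ρ : FunctionNorm μ}
  {𝕜 : Type*} [RCLike 𝕜]

theorem enorm_eq_gauge (f : ρ.space 𝕜) : ‖f‖ₑ = ρ.gauge f.1 := by
  rw [← ofReal_norm, ofReal_norm_eq]

/-! ### Disjointly supported sequences -/

/-- Upper and lower estimates ask for supports that are disjoint everywhere, whereas classes have
disjoint supports only almost everywhere. Cutting off to one set of full measure reconciles the two.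
-/
theorem exists_disjoint_enorm {φ : ℕ → ρ.space 𝕜}
    (hφ : DisjointlySupported fun n => (φ n : Ω →ₘ[μ] 𝕜)) :
    ∃ v : ℕ → Ω → ℝ≥0∞, (∀ i, Measurable (v i)) ∧
      (∀ i j, i ≠ j → Disjoint (Function.support (v i)) (Function.support (v j))) ∧
      ∀ i, ∀ᵐ ω ∂μ, v i ω = ‖(φ i).1 ω‖ₑ := by
  let G : Set Ω := ⋂ m, ⋂ n, ⋂ (_ : m ≠ n), {ω | (φ m).1 ω = 0} ∪ {ω | (φ n).1 ω = 0}
  have h0 : ∀ n, MeasurableSet {ω | (φ n).1 ω = 0} := fun n =>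
    (φ n).1.stronglyMeasurable.measurable (measurableSet_singleton 0)
  have hG : MeasurableSet G := MeasurableSet.iInter fun m => MeasurableSet.iInter fun n =>
    MeasurableSet.iInter fun _ => (h0 m).union (h0 n)
  have hGae : ∀ᵐ ω ∂μ, ω ∈ G := by
    simp only [G, Set.mem_iInter, ae_all_iff]
    exact fun m n hmn => hφ m n hmn
  refine ⟨fun i => G.indicator fun ω => ‖(φ i).1 ω‖ₑ, fun i => (measurable_enorm _).indicator hG,
    fun i j hij => Set.disjoint_left.2 fun ω hi hj => ?_, fun i => ?_⟩
  · have hω : ω ∈ G := Set.support_indicator_subset hi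
    simp only [Function.mem_support, Set.indicator_of_mem hω, enorm_ne_zero] at hi hj
    have := Set.mem_iInter.1 (Set.mem_iInter.1 (Set.mem_iInter.1 hω i) j) hij
    exact this.elim hi hj
  · filter_upwards [hGae] with ω hω
    exact Set.indicator_of_mem hω _

theorem enorm_sum_smul_eq {φ : ℕ → ρ.space 𝕜} {v : ℕ → Ω → ℝ≥0∞} (hv : ∀ i, Measurable (v i))
    (hdisj : ∀ i j, i ≠ j → Disjoint (Function.support (v i)) (Function.support (v j)))
    (hvφ : ∀ i, ∀ᵐ ω ∂μ, v i ω = ‖(φ i).1 ω‖ₑ) (a : ℕ → 𝕜) (s : Finset ℕ) :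
    ‖∑ i ∈ s, a i • φ i‖ₑ = ρ fun ω => ∑ i ∈ s, ‖a i‖ₑ * v i ω := by
  rw [enorm_eq_gauge]
  refine ρ.congr_ae (measurable_enorm _)
    (Finset.measurable_fun_sum _ fun i _ => (hv i).const_mul _) ?_
  filter_upwards [coeFn_finset_sum s fun i => a i • φ i,
    ae_all_iff.2 fun i => AEEqFun.coeFn_smul (a i) (φ i).1, ae_all_iff.2 hvφ] with ω h1 h2 h3
  have h4 : ∀ i, (a i • φ i).1 ω = a i • (φ i).1 ω := h2
  rw [h1]
  simp only [h4, h3]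
  by_cases hex : ∃ i, v i ω ≠ 0
  · obtain ⟨i, hi⟩ := hex
    have hz : ∀ j, j ≠ i → (φ j).1 ω = 0 := fun j hj => by
      by_contra h0
      refine Set.disjoint_left.1 (hdisj j i hj) ?_ hi
      rw [Function.mem_support, h3]
      exact enorm_ne_zero.2 h0
    by_cases his : i ∈ s
    · rw [Finset.sum_eq_single_of_mem i his fun j _ hj => by rw [hz j hj, smul_zero],
        Finset.sum_eq_single_of_mem i his fun j _ hj => by rw [hz j hj, enorm_zero, mul_zero],
        enorm_smul]
    · have hne : ∀ j ∈ s, (φ j).1 ω = 0 := fun j hj => hz j fun h => his (h ▸ hj)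
      rw [Finset.sum_eq_zero fun j hj => by rw [hne j hj, smul_zero],
        Finset.sum_eq_zero fun j hj => by rw [hne j hj, enorm_zero, mul_zero], enorm_zero]
  · push Not at hex
    have hz : ∀ i, (φ i).1 ω = 0 := fun i => by
      have := hex i
      rwa [h3, enorm_eq_zero] at this
    simp [hz]

theorem norm_sum_le_of_subset {φ : ℕ → ρ.space 𝕜}
    (hφ : DisjointlySupported fun n => (φ n : Ω →ₘ[μ] 𝕜)) (a : ℕ → 𝕜) {s t : Finset ℕ}
    (hst : s ⊆ t) : ‖∑ i ∈ s, a i • φ i‖ ≤ ‖∑ i ∈ t, a i • φ i‖ := by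
  obtain ⟨v, hv, hd, hvφ⟩ := exists_disjoint_enorm hφ
  rw [← enorm_le_iff_norm_le, enorm_sum_smul_eq hv hd hvφ, enorm_sum_smul_eq hv hd hvφ]
  exact ρ.mono_of_le (Finset.measurable_fun_sum _ fun i _ => (hv i).const_mul _)
    (Finset.measurable_fun_sum _ fun i _ => (hv i).const_mul _)
    fun ω => Finset.sum_le_sum_of_subset hst

theorem LowerEstimate.exists_le_enorm {r : ℝ} (h : ρ.LowerEstimate r) {φ : ℕ → ρ.space 𝕜}
    (hφ : DisjointlySupported fun n => (φ n : Ω →ₘ[μ] 𝕜)) :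
    ∃ C : ℝ≥0, ∀ (m : ℕ) (a : ℕ → 𝕜),
      (∑ i ∈ Finset.range m, (‖a i‖ₑ * ‖φ i‖ₑ) ^ r) ^ (1 / r) ≤
        C * ‖∑ i ∈ Finset.range m, a i • φ i‖ₑ := by
  obtain ⟨v, hv, hd, hvφ⟩ := exists_disjoint_enorm hφ
  obtain ⟨C, hC⟩ := h
  refine ⟨C, fun m a => ?_⟩
  have := hC m (fun i ω => ‖a i‖ₑ * v i ω) (fun i => (hv i).const_mul _) fun i j hij =>
    (hd i j fun h => hij (Fin.ext h)).mono (Function.support_mul_subset_right _ _)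
      (Function.support_mul_subset_right _ _)
  rw [enorm_sum_smul_eq hv hd hvφ]
  simp only [Finset.sum_range]
  convert this using 5 with i
  rw [ρ.const_mul _ _ (hv i), enorm_eq_gauge,
    ρ.congr_ae (hv i) (measurable_enorm _) (hvφ i), gauge]

theorem UpperEstimate.exists_enorm_le {r : ℝ} (h : ρ.UpperEstimate r) {φ : ℕ → ρ.space 𝕜}
    (hφ : DisjointlySupported fun n => (φ n : Ω →ₘ[μ] 𝕜)) :
    ∃ C : ℝ≥0, ∀ (m : ℕ) (a : ℕ → 𝕜), ‖∑ i ∈ Finset.range m, a i • φ i‖ₑ ≤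
      C * (∑ i ∈ Finset.range m, (‖a i‖ₑ * ‖φ i‖ₑ) ^ r) ^ (1 / r) := by
  obtain ⟨v, hv, hd, hvφ⟩ := exists_disjoint_enorm hφ
  obtain ⟨C, hC⟩ := h
  refine ⟨C, fun m a => ?_⟩
  have := hC m (fun i ω => ‖a i‖ₑ * v i ω) (fun i => (hv i).const_mul _) fun i j hij =>
    (hd i j fun h => hij (Fin.ext h)).mono (Function.support_mul_subset_right _ _)
      (Function.support_mul_subset_right _ _)
  rw [enorm_sum_smul_eq hv hd hvφ]
  simp only [Finset.sum_range]
  convert this using 5 with i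
  rw [ρ.const_mul _ _ (hv i), enorm_eq_gauge,
    ρ.congr_ae (hv i) (measurable_enorm _) (hvφ i), gauge]

/-! ### Disjointification -/

/-- Simple functions `u k` tend to `g` with `‖u k‖ ≤ 2 ‖g‖`. They are cut to the part of `B` where
`‖u k‖` has already reached `l`; since `l < ‖g‖` strictly on `B`, each point of `B` is eventually
kept. Dominated convergence with majorant `3 ‖g‖` finishes. -/
theorem OrderContinuous.exists_simple_approx (hρ : ρ.OrderContinuous) (g : ρ.space 𝕜) {B : Set Ω}
    (hB : MeasurableSet B) {l : Ω → ℝ≥0∞} (hl : Measurable l) (hlB : ∀ ω ∈ B, l ω < ‖g.1 ω‖ₑ)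
    {η : ℝ≥0∞} (hη : 0 < η) :
    ∃ (φ : ρ.space 𝕜) (s : SimpleFunc Ω 𝕜), φ.1 =ᵐ[μ] s ∧ (∀ ω, s ω ≠ 0 → ω ∈ B ∧ l ω ≤ ‖s ω‖ₑ) ∧
      ‖g - φ‖ₑ ≤ ρ (Bᶜ.indicator fun ω => ‖g.1 ω‖ₑ) + η := by
  have hg : Measurable g.1 := g.1.stronglyMeasurable.measurable
  have hge : Measurable fun ω => ‖g.1 ω‖ₑ := measurable_enorm _
  let u : ℕ → SimpleFunc Ω 𝕜 := SimpleFunc.approxOn g.1 hg Set.univ 0 (Set.mem_univ 0)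
  have hu_lim : ∀ ω, Tendsto (fun k => u k ω) atTop (𝓝 (g.1 ω)) := fun ω =>
    SimpleFunc.tendsto_approxOn hg (Set.mem_univ 0) (by simp)
  have hu_le : ∀ k ω, ‖u k ω‖ₑ ≤ 2 * ‖g.1 ω‖ₑ := fun k ω => by
    have h1 := SimpleFunc.norm_approxOn_zero_le hg (Set.mem_univ 0) ω k
    rw [← ofReal_norm, ← ofReal_norm, two_mul, ← ENNReal.ofReal_add (norm_nonneg _) (norm_nonneg _)]
    exact ENNReal.ofReal_le_ofReal h1
  let E : ℕ → Set Ω := fun k => B ∩ {ω | l ω ≤ ‖u k ω‖ₑ}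
  have hE : ∀ k, MeasurableSet (E k) := fun k =>
    hB.inter (measurableSet_le hl (u k).measurable.enorm)
  let t : ℕ → SimpleFunc Ω 𝕜 := fun k => (u k).restrict (E k)
  have ht : ∀ k, (t k : Ω → 𝕜) = (E k).indicator (u k) := fun k => SimpleFunc.coe_restrict _ (hE k)
  have ht_le : ∀ k ω, ‖t k ω‖ₑ ≤ 2 * ‖g.1 ω‖ₑ := fun k ω => by
    rw [ht]
    by_cases hω : ω ∈ E k
    · rw [Set.indicator_of_mem hω]
      exact hu_le k ω
    · rw [Set.indicator_of_notMem hω, enorm_zero]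
      exact zero_le
  have htm : ∀ k, Measurable (t k) := fun k => (t k).measurable
  have hmem : ∀ k, AEEqFun.mk (t k) (htm k).aestronglyMeasurable ∈ ρ.space 𝕜 := fun k => by
    refine lt_of_le_of_lt (ρ.gauge_le (hge.const_mul 2) ?_)
      ((ρ.const_mul 2 _ hge).trans_lt (ENNReal.mul_lt_top ENNReal.ofNat_lt_top g.2))
    filter_upwards [AEEqFun.coeFn_mk (t k) (htm k).aestronglyMeasurable] with ω h1
    rw [h1]
    exact ht_le k ω
  let d : ℕ → Ω → ℝ≥0∞ := fun k => B.indicator fun ω => ‖g.1 ω - t k ω‖ₑ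
  have hdm : ∀ k, Measurable (d k) := fun k => (hg.sub (htm k)).enorm.indicator hB
  have hd : Tendsto (fun k => ρ (d k)) atTop (𝓝 0) := by
    refine hρ.tendsto_zero (F := fun ω => 3 * ‖g.1 ω‖ₑ) (hge.const_mul 3)
      ((ρ.const_mul 3 _ hge).trans_lt (ENNReal.mul_lt_top ENNReal.ofNat_lt_top g.2)) hdm
      (fun k => Eventually.of_forall fun ω => ?_) (Eventually.of_forall fun ω => ?_)
    · refine (Set.indicator_le_self _ _ ω).trans (enorm_sub_le.trans ?_)
      calc _ ≤ ‖g.1 ω‖ₑ + 2 * ‖g.1 ω‖ₑ := by gcongr; exact ht_le k ω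
        _ = 3 * ‖g.1 ω‖ₑ := by ring
    · by_cases hω : ω ∈ B
      · have h1 : ∀ᶠ k in atTop, l ω < ‖u k ω‖ₑ :=
          (hu_lim ω).enorm.eventually (lt_mem_nhds (hlB ω hω))
        have h2 : Tendsto (fun k => ‖g.1 ω - u k ω‖ₑ) atTop (𝓝 0) := by
          have := (tendsto_const_nhds (x := g.1 ω)).sub (hu_lim ω)
          rw [sub_self] at this
          simpa using this.enorm
        refine h2.congr' ?_
        filter_upwards [h1] with k hk
        simp only [d]
        rw [Set.indicator_of_mem hω, ht, Set.indicator_of_mem (show ω ∈ E k from ⟨hω, hk.le⟩)]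
      · simp [d, hω]
  obtain ⟨k, hk⟩ := (hd.eventually (gt_mem_nhds hη)).exists
  refine ⟨⟨_, hmem k⟩, t k, AEEqFun.coeFn_mk _ _, fun ω hω => ?_, ?_⟩
  · rw [ht] at hω ⊢
    have hωE : ω ∈ E k := by
      by_contra h0
      exact hω (Set.indicator_of_notMem h0 _)
    rw [Set.indicator_of_mem hωE]
    exact hωE
  · have hBm : Measurable (Bᶜ.indicator fun ω => ‖g.1 ω‖ₑ) := hge.indicator hB.compl
    rw [enorm_eq_gauge]
    calc _ ≤ ρ (fun ω => (Bᶜ.indicator (fun ω => ‖g.1 ω‖ₑ)) ω + d k ω) := by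
          refine ρ.gauge_le (hBm.add (hdm k)) ?_
          filter_upwards [AEEqFun.coeFn_sub g.1 (AEEqFun.mk (t k) (htm k).aestronglyMeasurable),
            AEEqFun.coeFn_mk (t k) (htm k).aestronglyMeasurable] with ω h1 h2
          have h3 : (g - ⟨_, hmem k⟩ : ρ.space 𝕜).1 ω = g.1 ω - t k ω := by
            rw [← h2]; exact h1
          rw [h3]
          by_cases hω : ω ∈ B
          · simp [d, hω]
          · have : t k ω = 0 := by
              rw [ht]
              exact Set.indicator_of_notMem (fun h => hω h.1) _
            simp [d, hω, this]
      _ ≤ _ := (ρ.add_le _ _ hBm (hdm k)).trans (by gcongr)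

/-- A sequence in `L_ρ` which vanishes almost everywhere in the limit has a subsequence which is a
small perturbation of a disjointly supported sequence of simple functions. -/
theorem OrderContinuous.exists_disjoint_simple_subsequence [SigmaFinite μ]
    (hρ : ρ.OrderContinuous) (f : ℕ → ρ.space 𝕜)
    (hf : ∀ᵐ ω ∂μ, Tendsto (fun n => ‖(f n).1 ω‖ₑ) atTop (𝓝 0)) {δ : ℝ≥0∞} (hδ : 0 < δ) :
    ∃ k : ℕ → ℕ, StrictMono k ∧ ∃ φ : ℕ → ρ.space 𝕜, (∀ n, ‖f (k n) - φ n‖ₑ ≤ δ * 2⁻¹ ^ n) ∧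
      DisjointlySupported (fun n => (φ n : Ω →ₘ[μ] 𝕜)) ∧
      (∀ n, IsSimple (φ n : Ω →ₘ[μ] 𝕜)) ∧
      (μ Set.univ < ∞ → EscapesToInfinity fun n => (φ n : Ω →ₘ[μ] 𝕜)) := by
  obtain ⟨w, hw, hw0, hρw, hw1⟩ := ρ.exists_weight
  -- Three errors share `δ * 2⁻¹ ^ n`: the part below a multiple of the weight, the part on later
  -- sets, and the simple approximation.
  let η : ℕ → ℝ≥0∞ := fun n => δ / 3 * 2⁻¹ ^ n
  have hη : ∀ n, 0 < η n := fun n =>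
    ENNReal.mul_pos (ENNReal.div_pos hδ.ne' ENNReal.ofNat_ne_top).ne'
      (pow_ne_zero _ (ENNReal.inv_ne_zero.2 ENNReal.ofNat_ne_top))
  have hηanti : Antitone η := fun m n hmn =>
    mul_le_mul_right (pow_le_pow_right_of_le_one' (ENNReal.inv_le_one.2 one_le_two) hmn) _
  have hη3 : ∀ n, η n + η n + η n = δ * 2⁻¹ ^ n := fun n => by
    have : η n + η n + η n = (δ / 3 * 3) * 2⁻¹ ^ n := by simp only [η]; ring
    rw [this, ENNReal.div_mul_cancel (by norm_num) ENNReal.ofNat_ne_top]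
  have hem : ∀ n, Measurable fun ω => ‖(f n).1 ω‖ₑ := fun n => measurable_enorm _
  -- the part below a multiple of the weight is negligible
  have hsmall : ∀ M : ℕ, Tendsto (fun n => ρ ({ω | M * w ω < ‖(f n).1 ω‖ₑ}ᶜ.indicator
      fun ω => ‖(f n).1 ω‖ₑ)) atTop (𝓝 0) := by
    intro M
    refine hρ.tendsto_zero (F := fun ω => M * w ω) (hw.const_mul _)
      ((ρ.const_mul _ _ hw).trans_lt (ENNReal.mul_lt_top (ENNReal.natCast_lt_top M) hρw))
      (fun n => (hem n).indicator (measurableSet_lt (hw.const_mul _) (hem n)).compl)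
      (fun n => Eventually.of_forall fun ω => ?_) ?_
    · by_cases hω : ω ∈ {ω | M * w ω < ‖(f n).1 ω‖ₑ}ᶜ
      · rw [Set.indicator_of_mem hω]
        exact not_lt.1 hω
      · rw [Set.indicator_of_notMem hω]
        exact zero_le
    · filter_upwards [hf] with ω h1
      exact tendsto_of_tendsto_of_tendsto_of_le_of_le tendsto_const_nhds h1
        (fun _ => zero_le) fun n => Set.indicator_le_self _ _ ω
  obtain ⟨k₁, hk₁, hk₁η⟩ := extraction_forall_of_eventually fun n : ℕ =>
    ((hsmall n).eventually (gt_mem_nhds (hη n)))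
  let A : ℕ → Set Ω := fun n => {ω | n * w ω < ‖(f (k₁ n)).1 ω‖ₑ}
  have hA : ∀ n, MeasurableSet (A n) := fun n => measurableSet_lt (hw.const_mul _) (hem _)
  let C : ℕ → Set Ω := fun n => ⋃ m ≥ n, A m
  have hC : ∀ n, MeasurableSet (C n) := fun n =>
    MeasurableSet.iUnion fun m => MeasurableSet.iUnion fun _ => hA m
  have hCanti : Antitone C := fun m n hmn =>
    Set.iUnion_mono fun i => Set.iUnion_mono' fun hi => ⟨hmn.trans hi, subset_rfl⟩
  have hCnull : ∀ᵐ ω ∂μ, ∃ n, ω ∉ C n := by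
    filter_upwards [hf] with ω h1
    obtain ⟨n, hn⟩ := eventually_atTop.1
      ((h1.comp hk₁.tendsto_atTop).eventually (gt_mem_nhds (hw0 ω)))
    -- The shift ensures `m ≥ 1`, so that `‖f‖ < w` implies `‖f‖ ≤ m * w`.
    refine ⟨n + 1, ?_⟩
    simp only [C, A, Set.mem_iUnion, Set.mem_ofPred_eq, not_exists, not_lt]
    intro m hm
    have hm1 : (1 : ℝ≥0∞) ≤ m := by exact_mod_cast le_trans (Nat.le_add_left 1 n) hm
    exact (hn m (by omega)).le.trans (le_mul_of_one_le_left zero_le hm1)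
  have hnext : ∀ n, ∃ m, n < m ∧ ρ ((C m).indicator fun ω => ‖(f (k₁ n)).1 ω‖ₑ) < η n := by
    intro n
    have := hρ _ (hem (k₁ n)) (f (k₁ n)).2 C hC hCanti hCnull
    obtain ⟨m, hm1, hm2⟩ := ((eventually_gt_atTop n).and
      (this.eventually (gt_mem_nhds (hη n)))).exists
    exact ⟨m, hm1, hm2⟩
  choose next hnext_lt hnext using hnext
  let κ : ℕ → ℕ := fun n => next^[n] 0
  have hκ_succ : ∀ n, κ (n + 1) = next (κ n) := fun n => Function.iterate_succ_apply' _ _ _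
  have hκ : StrictMono κ := strictMono_nat_of_lt_succ fun n => by
    rw [hκ_succ]; exact hnext_lt _
  -- Removing all later sets `A m` makes the `B n` disjoint; by the choice of `next` the removed
  -- part has small norm.
  let B : ℕ → Set Ω := fun n => A (κ n) \ C (κ (n + 1))
  have hB : ∀ n, MeasurableSet (B n) := fun n => (hA _).diff (hC _)
  have hBlt : ∀ i j, i < j → Disjoint (B i) (B j) := fun i j hij =>
    Set.disjoint_left.2 fun ω h1 h2 => h1.2
      (Set.mem_iUnion₂.2 ⟨κ j, hκ.monotone hij, h2.1⟩)
  have hBd : ∀ i j, i ≠ j → Disjoint (B i) (B j) := fun i j hij =>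
    hij.lt_or_gt.elim (hBlt i j) fun h => (hBlt j i h).symm
  have hBc : ∀ n, ρ ((B n)ᶜ.indicator fun ω => ‖(f (k₁ (κ n))).1 ω‖ₑ) ≤ η n + η n := by
    intro n
    have m1 := (hem (k₁ (κ n))).indicator (hA (κ n)).compl
    have m2 := (hem (k₁ (κ n))).indicator (hC (κ (n + 1)))
    calc _ ≤ ρ (fun ω => (A (κ n))ᶜ.indicator (fun ω => ‖(f (k₁ (κ n))).1 ω‖ₑ) ω +
            (C (κ (n + 1))).indicator (fun ω => ‖(f (k₁ (κ n))).1 ω‖ₑ) ω) := by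
          refine ρ.mono_of_le ((hem _).indicator (hB n).compl) (m1.add m2) fun ω => ?_
          by_cases h1 : ω ∈ A (κ n) <;> by_cases h2 : ω ∈ C (κ (n + 1)) <;> simp [B, h1, h2]
      _ ≤ _ := ρ.add_le _ _ m1 m2
      _ ≤ η (κ n) + η (κ n) := by
          refine add_le_add (hk₁η (κ n)).le ?_
          have := hnext (κ n)
          rw [← hκ_succ] at this
          exact this.le
      _ ≤ η n + η n := add_le_add (hηanti hκ.le_apply) (hηanti hκ.le_apply)
  choose φ s hφs hs hφ using fun n => hρ.exists_simple_approx (f (k₁ (κ n))) (hB n)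
    (hw.const_mul (κ n : ℝ≥0∞)) (fun ω hω => hω.1) (hη n)
  refine ⟨k₁ ∘ κ, hk₁.comp hκ, φ, fun n => ?_, fun m n hmn => ?_, fun n => ⟨s n, hφs n⟩,
    fun hfin => ?_⟩
  · refine (hφ n).trans ?_
    rw [← hη3]
    gcongr
    exact hBc n
  · filter_upwards [hφs m, hφs n] with ω h1 h2
    rw [h1, h2]
    by_contra! hne
    exact Set.disjoint_left.1 (hBd m n hmn) (hs m ω hne.1).1 (hs n ω hne.2).1
  -- For finite measure the weight is `1`, so the nonzero values of `φ n` have modulus at least `κ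
  -- n`.
  · refine tendsto_nhds_top_mono (ENNReal.tendsto_nat_nhds_top.comp hκ.tendsto_atTop)
      (Eventually.of_forall fun n => ?_)
    refine le_essInf_of_ae_le _ ?_
    have hsupp : MeasurableSet (Function.support (φ n).1) :=
      (φ n).1.stronglyMeasurable.measurable (measurableSet_singleton 0).compl
    rw [EventuallyLE, ae_restrict_iff' hsupp]
    filter_upwards [hφs n] with ω h1 h2
    rw [Function.mem_support, h1] at h2
    have := (hs n ω h2).2
    rw [hw1 hfin, mul_one] at this
    rw [h1]
    exact this

end FunctionNorm

/-! ### Sequences equivalent to the unit vectors of `ℓ₂` -/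

section hilbert

variable {𝕜 : Type*} [RCLike 𝕜] {X : Type*} [NormedAddCommGroup X] [NormedSpace 𝕜 X]

theorem norm_sum_unitVectors (a : ℕ → 𝕜) (s : Finset ℕ) :
    ‖∑ i ∈ s, a i • unitVectors 𝕜 i‖ = √(∑ i ∈ s, ‖a i‖ ^ 2) := by
  have h := lp.norm_sum_single (p := 2) (E := fun _ : ℕ => 𝕜) (by norm_num) a s
  have h1 : ∀ i, a i • unitVectors 𝕜 i = lp.single 2 i (a i) := fun i => by
    rw [unitVectors, ← lp.single_smul, smul_eq_mul, mul_one]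
  simp only [h1]
  simp only [ENNReal.toReal_ofNat, Real.rpow_ofNat] at h
  rw [← h, Real.sqrt_sq (norm_nonneg _)]

/-- Signs are chosen twice: in each Hilbert space `H j`, to bound the sum of squares from above by
the norm of an image, and in `X`, to use type 2. Unconditionality compares both signed sums with the
unsigned one. The good index `j` may vary with `n`, so the Hilbert estimates are summed over all
`j`. -/
theorem equivalentSeq_unitVectors [CompleteSpace X] {ι : Type*} [Fintype ι] {H : ι → Type*}
    [∀ j, NormedAddCommGroup (H j)] [∀ j, InnerProductSpace 𝕜 (H j)] (T : ∀ j, X →L[𝕜] H j)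
    (htype : HasRademacherType X 2) {x : ℕ → X} (hx : IsUnconditionalBasicSequence 𝕜 x)
    {c D : ℝ} (hc : 0 < c) (hTx : ∀ n, ∃ j, c ≤ ‖T j (x n)‖) (hD : ∀ n, ‖x n‖ ≤ D) :
    EquivalentSeq 𝕜 x (unitVectors 𝕜) := by
  obtain ⟨K, hK0, hK⟩ := hx.exists_norm_sum_le
  have hD0 : 0 ≤ D := (norm_nonneg _).trans (hD 0)
  refine ⟨?_, ?_⟩
  · refine dominates_of_norm_sum_le (√(∑ j, (‖T j‖ * (2 * K)) ^ 2) / c) fun m a => ?_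
    rw [norm_sum_unitVectors]
    set S := ‖∑ i ∈ Finset.range m, a i • x i‖ with hS
    have hj : ∀ j, ∑ i ∈ Finset.range m, ‖T j (a i • x i)‖ ^ 2 ≤ (‖T j‖ * (2 * K) * S) ^ 2 := by
      intro j
      obtain ⟨ε, hε⟩ := exists_signs_sum_sq_le (𝕜 := 𝕜) (fun i => T j (a i • x i)) m
      refine hε.trans ?_
      have h1 : ∑ i ∈ Finset.range m, ε i • T j (a i • x i) =
          T j (∑ i ∈ Finset.range m, ε i • a i • x i) := by
        rw [map_sum]
        refine Finset.sum_congr rfl fun i _ => ?_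
        simp only [Units.smul_def, map_zsmul]
      rw [h1]
      gcongr
      calc _ ≤ ‖T j‖ * ‖∑ i ∈ Finset.range m, ε i • a i • x i‖ := (T j).le_opNorm _
        _ ≤ ‖T j‖ * (2 * K * S) := by gcongr; exact norm_sum_units_smul_le hK ε a _
        _ = _ := by ring
    have hsum : c ^ 2 * ∑ i ∈ Finset.range m, ‖a i‖ ^ 2 ≤
        (∑ j, (‖T j‖ * (2 * K)) ^ 2) * S ^ 2 := by
      calc c ^ 2 * ∑ i ∈ Finset.range m, ‖a i‖ ^ 2
          ≤ ∑ i ∈ Finset.range m, ∑ j, ‖T j (a i • x i)‖ ^ 2 := by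
            rw [Finset.mul_sum]
            refine Finset.sum_le_sum fun i _ => ?_
            obtain ⟨j, hj⟩ := hTx i
            refine le_trans ?_ (Finset.single_le_sum (f := fun j => ‖T j (a i • x i)‖ ^ 2)
              (fun _ _ => by positivity) (Finset.mem_univ j))
            simp only [map_smul, norm_smul, mul_pow]
            rw [mul_comm]
            gcongr
        _ = ∑ j, ∑ i ∈ Finset.range m, ‖T j (a i • x i)‖ ^ 2 := Finset.sum_comm
        _ ≤ ∑ j, (‖T j‖ * (2 * K) * S) ^ 2 := Finset.sum_le_sum fun j _ => hj j
        _ = _ := by simp only [mul_pow, Finset.sum_mul]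
    rw [div_mul_eq_mul_div, le_div_iff₀ hc]
    have := Real.sqrt_le_sqrt hsum
    rw [Real.sqrt_mul (by positivity), Real.sqrt_mul (by positivity), Real.sqrt_sq hc.le,
      Real.sqrt_sq (norm_nonneg _)] at this
    linarith
  · obtain ⟨C, hC0, hC⟩ := htype.exists_signs
    refine dominates_of_norm_sum_le (2 * K * (C * D)) fun m a => ?_
    rw [norm_sum_unitVectors]
    obtain ⟨ε, hε⟩ := hC m fun i => a i • x i
    calc _ ≤ 2 * K * ‖∑ i ∈ Finset.range m, ε i • a i • x i‖ :=
          norm_sum_le_norm_sum_units_smul hK ε a _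
      _ ≤ 2 * K * (C * √(∑ i ∈ Finset.range m, ‖a i • x i‖ ^ 2)) := by gcongr
      _ ≤ 2 * K * (C * √(D ^ 2 * ∑ i ∈ Finset.range m, ‖a i‖ ^ 2)) := by
          gcongr
          rw [Finset.mul_sum]
          refine Finset.sum_le_sum fun i _ => ?_
          rw [norm_smul, mul_pow, mul_comm]
          gcongr
          exact hD i
      _ = _ := by
          rw [Real.sqrt_mul (by positivity), Real.sqrt_sq hD0]
          ring

end hilbert

/-! ### Subsequences and perturbations -/

section subsequences

/-- As no term vanishes, a value below the minimum of an initial segment must occur after it; small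
values therefore recur arbitrarily late. -/
theorem exists_subsequence_tendsto_zero {u : ℕ → ℝ} (hu : ∀ n, 0 < u n)
    (h : ∀ c > 0, ∃ n, u n < c) : ∃ k : ℕ → ℕ, StrictMono k ∧ Tendsto (u ∘ k) atTop (𝓝 0) := by
  have hfreq : ∀ c : ℝ, 0 < c → ∃ᶠ n in atTop, u n < c := by
    intro c hc
    rw [frequently_atTop]
    intro N
    obtain ⟨i, -, hi⟩ := Finset.exists_min_image (Finset.range (N + 1)) u ⟨0, by simp⟩
    obtain ⟨n, hn⟩ := h (min c (u i)) (lt_min hc (hu i))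
    refine ⟨n, ?_, hn.trans_le (min_le_left _ _)⟩
    by_contra hlt
    exact absurd (hn.trans_le (min_le_right _ _))
      (not_lt.2 (hi n (Finset.mem_range.2 (by omega))))
  obtain ⟨k, hk, hku⟩ := extraction_forall_of_frequently fun n : ℕ =>
    hfreq (1 / ((n : ℝ) + 1)) Nat.one_div_pos_of_nat
  exact ⟨k, hk, squeeze_zero (fun n => (hu _).le) (fun n => (hku n).le)
    tendsto_one_div_add_atTop_nhds_zero_nat⟩

theorem exists_common_subsequence {ι : Type*} [Finite ι] (P : ι → (ℕ → ℕ) → Prop)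
    (hsub : ∀ (j : ι) (k l : ℕ → ℕ), StrictMono l → P j k → P j (k ∘ l))
    (hex : ∀ (j : ι) (k : ℕ → ℕ), StrictMono k → ∃ l : ℕ → ℕ, StrictMono l ∧ P j (k ∘ l)) :
    ∃ k, StrictMono k ∧ ∀ j, P j k := by
  classical
  have := Fintype.ofFinite ι
  suffices h : ∀ s : Finset ι, ∃ k, StrictMono k ∧ ∀ j ∈ s, P j k by
    obtain ⟨k, hk, hkP⟩ := h Finset.univ
    exact ⟨k, hk, fun j => hkP j (Finset.mem_univ j)⟩
  intro s
  induction s using Finset.induction_on with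
  | empty => exact ⟨id, strictMono_id, by simp⟩
  | insert j s _ ih =>
    obtain ⟨k, hk, hkP⟩ := ih
    obtain ⟨l, hl, hlP⟩ := hex j k hk
    exact ⟨k ∘ l, hk.comp hl, Finset.forall_mem_insert _ _ _ |>.2
      ⟨hlP, fun i hi => hsub i k l hl (hkP i hi)⟩⟩

variable {𝕜 : Type*} [RCLike 𝕜] {X : Type*} [NormedAddCommGroup X] [NormedSpace 𝕜 X]

theorem norm_sum_le_comp {x : ℕ → X} {K : ℝ}
    (h : ∀ (a : ℕ → 𝕜) (s t : Finset ℕ), s ⊆ t →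
      ‖∑ i ∈ s, a i • x i‖ ≤ K * ‖∑ i ∈ t, a i • x i‖) {k : ℕ → ℕ} (hk : StrictMono k)
    (a : ℕ → 𝕜) (s t : Finset ℕ) (hst : s ⊆ t) :
    ‖∑ i ∈ s, a i • x (k i)‖ ≤ K * ‖∑ i ∈ t, a i • x (k i)‖ := by
  -- The coefficients are transported along `k` and set to zero off its range.
  have := h (Function.extend k a 0) (s.map ⟨k, hk.injective⟩) (t.map ⟨k, hk.injective⟩)
    (Finset.map_subset_map.2 hst)
  simpa [Finset.sum_map, hk.injective.extend_apply] using this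

/-- The factor `2` is the sum of the geometric series. In applications `R` is a multiple of the norm
of a sum, since unconditionality bounds each coefficient. -/
theorem norm_sum_smul_le_add {x y : ℕ → X} {δ R : ℝ} (hδ : 0 ≤ δ) (hR : 0 ≤ R)
    (hxy : ∀ n, ‖x n - y n‖ ≤ δ * (1 / 2) ^ n) {m : ℕ} {a : ℕ → 𝕜} (ha : ∀ i < m, ‖a i‖ ≤ R) :
    ‖∑ i ∈ Finset.range m, a i • x i‖ ≤ ‖∑ i ∈ Finset.range m, a i • y i‖ + 2 * δ * R := by
  have h1 : ∑ i ∈ Finset.range m, a i • x i =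
      ∑ i ∈ Finset.range m, a i • y i + ∑ i ∈ Finset.range m, a i • (x i - y i) := by
    rw [← Finset.sum_add_distrib]
    refine Finset.sum_congr rfl fun i _ => ?_
    rw [smul_sub, add_sub_cancel]
  rw [h1]
  refine (norm_add_le _ _).trans (add_le_add le_rfl ?_)
  calc _ ≤ ∑ i ∈ Finset.range m, R * (δ * (1 / 2) ^ i) := by
        refine norm_sum_le_of_le _ fun i hi => ?_
        rw [norm_smul]
        exact mul_le_mul (ha i (Finset.mem_range.1 hi)) (hxy i) (norm_nonneg _) hR
    _ = R * δ * ∑ i ∈ Finset.range m, (1 / 2 : ℝ) ^ i := by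
        rw [Finset.mul_sum]
        exact Finset.sum_congr rfl fun i _ => by ring
    _ ≤ R * δ * 2 := by gcongr; exact sum_geometric_two_le m
    _ = _ := by ring

end subsequences

/-! ### Comparison of disjointly supported sequences -/

/-- Each `b i` is at most the `ℓ_p` norm `S`, so `b i ^ q ≤ b i ^ p * S ^ (q - p)`. -/
theorem ENNReal.rpow_sum_rpow_anti {ι : Type*} (s : Finset ι) (b : ι → ℝ≥0∞) {p q : ℝ}
    (hp : 0 < p) (hpq : p ≤ q) :
    (∑ i ∈ s, b i ^ q) ^ (1 / q) ≤ (∑ i ∈ s, b i ^ p) ^ (1 / p) := by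
  have hq : 0 < q := hp.trans_le hpq
  set S := (∑ i ∈ s, b i ^ p) ^ (1 / p) with hS
  have hSp : S ^ p = ∑ i ∈ s, b i ^ p := by
    rw [hS, ← ENNReal.rpow_mul, one_div_mul_cancel hp.ne', ENNReal.rpow_one]
  have hb : ∀ i ∈ s, b i ≤ S := fun i hi => by
    rw [← ENNReal.rpow_le_rpow_iff hp, hSp]
    exact Finset.single_le_sum (f := fun i => b i ^ p) (fun _ _ => zero_le) hi
  rw [one_div, ENNReal.rpow_inv_le_iff hq]
  have hsplit : ∀ c : ℝ≥0∞, c ^ q = c ^ p * c ^ (q - p) := fun c => by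
    rw [← ENNReal.rpow_add_of_nonneg _ _ hp.le (sub_nonneg.2 hpq), add_sub_cancel]
  calc ∑ i ∈ s, b i ^ q ≤ ∑ i ∈ s, b i ^ p * S ^ (q - p) := by
        refine Finset.sum_le_sum fun i hi => ?_
        rw [hsplit]
        gcongr
        exact hb i hi
    _ = S ^ q := by rw [← Finset.sum_mul, ← hSp, ← hsplit]

/-- The lower estimate maps the first sequence to `ℓ_p`, which embeds in `ℓ_q`, and the upper
estimate maps `ℓ_q` to the second sequence. The norm bounds `c` and `D` pass from one normalization
to the other. -/
theorem exists_norm_sum_le_of_estimates {𝕜 : Type*} [RCLike 𝕜] {Ω Ω' : Type*} [MeasurableSpace Ω]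
    [MeasurableSpace Ω'] {μ : Measure Ω} {μ' : Measure Ω'} {ρ : FunctionNorm μ}
    {ρ' : FunctionNorm μ'} {p q : ℝ} (hp : 0 < p) (hpq : p ≤ q) (hlower : ρ.LowerEstimate p)
    (hupper : ρ'.UpperEstimate q) {φ : ℕ → ρ.space 𝕜} {φ' : ℕ → ρ'.space 𝕜}
    (hφ : DisjointlySupported fun n => (φ n : Ω →ₘ[μ] 𝕜))
    (hφ' : DisjointlySupported fun n => (φ' n : Ω' →ₘ[μ'] 𝕜)) {c D : ℝ} (hc : 0 < c)
    (hcφ : ∀ n, c ≤ ‖φ n‖) (hDφ' : ∀ n, ‖φ' n‖ ≤ D) :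
    ∃ K : ℝ, 0 ≤ K ∧ ∀ (m : ℕ) (a : ℕ → 𝕜), ‖∑ i ∈ Finset.range m, a i • φ' i‖ ≤
      K * ‖∑ i ∈ Finset.range m, a i • φ i‖ := by
  obtain ⟨C, hC⟩ := hlower.exists_le_enorm hφ
  obtain ⟨C', hC'⟩ := hupper.exists_enorm_le hφ'
  have hD : 0 ≤ D := (norm_nonneg _).trans (hDφ' 0)
  have hq : 0 < q := hp.trans_le hpq
  set L : ℝ≥0∞ := ENNReal.ofReal (D / c) with hL
  have hle : ∀ i, ‖φ' i‖ₑ ≤ L * ‖φ i‖ₑ := fun i => by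
    rw [← ofReal_norm, ← ofReal_norm, hL, ← ENNReal.ofReal_mul (by positivity)]
    refine ENNReal.ofReal_le_ofReal ((hDφ' i).trans ?_)
    rw [div_mul_eq_mul_div, le_div_iff₀ hc]
    exact mul_le_mul_of_nonneg_left (hcφ i) hD
  have key : ∀ (m : ℕ) (a : ℕ → 𝕜), ‖∑ i ∈ Finset.range m, a i • φ' i‖ₑ ≤
      C' * (L * (C * ‖∑ i ∈ Finset.range m, a i • φ i‖ₑ)) := fun m a => by
    refine (hC' m a).trans ?_
    gcongr
    calc (∑ i ∈ Finset.range m, (‖a i‖ₑ * ‖φ' i‖ₑ) ^ q) ^ (1 / q)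
        ≤ (∑ i ∈ Finset.range m, (‖a i‖ₑ * ‖φ' i‖ₑ) ^ p) ^ (1 / p) :=
          ENNReal.rpow_sum_rpow_anti _ _ hp hpq
      _ ≤ (∑ i ∈ Finset.range m, (L * (‖a i‖ₑ * ‖φ i‖ₑ)) ^ p) ^ (1 / p) := by
          refine ENNReal.rpow_le_rpow (Finset.sum_le_sum fun i _ =>
            ENNReal.rpow_le_rpow ?_ hp.le) (by positivity)
          rw [mul_left_comm]
          gcongr
          exact hle i
      _ = L * (∑ i ∈ Finset.range m, (‖a i‖ₑ * ‖φ i‖ₑ) ^ p) ^ (1 / p) := by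
          simp only [ENNReal.mul_rpow_of_nonneg L _ hp.le, ← Finset.mul_sum]
          rw [ENNReal.mul_rpow_of_nonneg _ _ (by positivity), ← ENNReal.rpow_mul,
            mul_one_div_cancel hp.ne', ENNReal.rpow_one]
      _ ≤ _ := by gcongr; exact hC m a
  refine ⟨C' * (D / c * C), by positivity, fun m a => ?_⟩
  have := key m a
  rw [← ofReal_norm, ← ofReal_norm, hL, ← ENNReal.ofReal_coe_nnreal, ← ENNReal.ofReal_coe_nnreal,
    ← ENNReal.ofReal_mul (by positivity), ← ENNReal.ofReal_mul (by positivity),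
    ← ENNReal.ofReal_mul (by positivity), ENNReal.ofReal_le_ofReal_iff (by positivity)] at this
  linarith

/-! ### The inclusion operator and almost everywhere convergence -/

namespace FunctionNorm

variable {Ω : Type*} [MeasurableSpace Ω] {μ : Measure Ω} {ρ : FunctionNorm μ}
  {𝕜 : Type*} [RCLike 𝕜]

/-- The inclusion of `L_ρ` in `L₂`. -/
def inclusionL2 (hL2 : (ρ.space 𝕜).toAddSubgroup ≤ Lp 𝕜 2 μ) : ρ.space 𝕜 →L[𝕜] Lp 𝕜 2 μ :=
  LinearMap.mkContinuousOfExistsBound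
    { toFun f := ⟨f.1, hL2 f.2⟩
      map_add' _ _ := rfl
      map_smul' _ _ := rfl } <| by
    obtain ⟨B, hB⟩ := exists_eLpNorm_le hL2
    refine ⟨B, fun f => ?_⟩
    rw [Lp.norm_def, norm_def]
    have := ENNReal.toReal_mono (ENNReal.mul_ne_top ENNReal.coe_ne_top (gauge_ne_top f)) (hB f)
    rwa [ENNReal.toReal_mul, ENNReal.coe_toReal] at this

theorem coe_inclusionL2 (hL2 : (ρ.space 𝕜).toAddSubgroup ≤ Lp 𝕜 2 μ) (f : ρ.space 𝕜) :
    (inclusionL2 hL2 f : Ω →ₘ[μ] 𝕜) = f.1 := rfl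

theorem inclusionL2_injective (hL2 : (ρ.space 𝕜).toAddSubgroup ≤ Lp 𝕜 2 μ) :
    Function.Injective (inclusionL2 hL2) := fun f g h =>
  Subtype.ext (by rw [← coe_inclusionL2 hL2, h, coe_inclusionL2])

theorem exists_subsequence_ae_tendsto (hL2 : (ρ.space 𝕜).toAddSubgroup ≤ Lp 𝕜 2 μ)
    {f : ℕ → ρ.space 𝕜} (hf : Tendsto (fun n => ‖inclusionL2 hL2 (f n)‖) atTop (𝓝 0)) :
    ∃ k : ℕ → ℕ, StrictMono k ∧
      ∀ᵐ ω ∂μ, Tendsto (fun n => ‖(f (k n)).1 ω‖ₑ) atTop (𝓝 0) := by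
  obtain ⟨k, hk, h⟩ := (tendstoInMeasure_of_tendsto_Lp
    (tendsto_zero_iff_norm_tendsto_zero.2 hf)).exists_seq_tendsto_ae
  refine ⟨k, hk, ?_⟩
  filter_upwards [h, Lp.coeFn_zero 𝕜 2 μ] with ω h1 h2
  rw [h2] at h1
  simp only [coe_inclusionL2] at h1
  simpa using h1.enorm

end FunctionNorm

/-! ### Direct sums of function spaces -/

section directSum

variable {𝕜 : Type*} [RCLike 𝕜] {ι : Type*} [Fintype ι] [LinearOrder ι] {Ω : ι → Type*}
  [∀ j, MeasurableSpace (Ω j)] {μ : ∀ j, Measure (Ω j)} {ρ : ∀ j, FunctionNorm (μ j)}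

theorem exists_first_coordinate {f : ℕ → ∀ j, (ρ j).space 𝕜} {c : ℝ} (hc : 0 < c)
    (hcf : ∀ n, c ≤ ‖f n‖) :
    ∃ (j₀ : ι) (d : ℝ) (k : ℕ → ℕ), 0 < d ∧ StrictMono k ∧ (∀ n, d ≤ ‖f (k n) j₀‖) ∧
      ∀ j < j₀, Tendsto (fun n => ‖f (k n) j‖) atTop (𝓝 0) := by
  have hne : ∃ j, ¬ Tendsto (fun n => ‖f n j‖) atTop (𝓝 0) := by
    by_contra! hall
    have h1 : Tendsto f atTop (𝓝 0) :=
      tendsto_pi_nhds.2 fun j => tendsto_zero_iff_norm_tendsto_zero.2 (hall j)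
    exact absurd (ge_of_tendsto' (tendsto_zero_iff_norm_tendsto_zero.1 h1) hcf) (not_le.2 hc)
  obtain ⟨j₀, hj₀, hmin⟩ := WellFounded.has_min (wellFounded_lt (α := ι))
    {j | ¬ Tendsto (fun n => ‖f n j‖) atTop (𝓝 0)} hne
  obtain ⟨d, hd, hfreq⟩ : ∃ d : ℝ, 0 < d ∧ ∃ᶠ n in atTop, d ≤ ‖f n j₀‖ := by
    by_contra! hall
    refine hj₀ (Metric.tendsto_nhds.2 fun d hd => ?_)
    filter_upwards [hall d hd] with n hn
    simpa using hn
  obtain ⟨k, hk, hkd⟩ := extraction_of_frequently_atTop hfreq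
  refine ⟨j₀, d, k, hd, hk, hkd, fun j hj => ?_⟩
  have : Tendsto (fun n => ‖f n j‖) atTop (𝓝 0) := by
    by_contra h
    exact hmin j h hj
  exact this.comp hk.tendsto_atTop

/-- At the first coordinate `j₀` that does not vanish in norm, projection gives one domination. For
the other, each coordinate is compared with its disjoint model, and all models are dominated by the
one at `j₀`. -/
theorem exists_coordinate_equivalentSeq [∀ j, SigmaFinite (μ j)]
    (hL2 : ∀ j, ((ρ j).space 𝕜).toAddSubgroup ≤ Lp 𝕜 2 (μ j))
    (hoc : ∀ j, (ρ j).OrderContinuous)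
    (hest : ∀ i j, i < j → ∃ p q : ℝ, 0 < p ∧ p ≤ q ∧ (ρ i).LowerEstimate p ∧
      (ρ j).UpperEstimate q)
    {f : ℕ → ∀ j, (ρ j).space 𝕜} (hnorm : SemiNormalized f) {K : ℝ} (hK0 : 0 ≤ K)
    (hK : ∀ (a : ℕ → 𝕜) (s t : Finset ℕ), s ⊆ t →
      ‖∑ i ∈ s, a i • f i‖ ≤ K * ‖∑ i ∈ t, a i • f i‖)
    (hf2 : ∀ j, Tendsto (fun n => ‖FunctionNorm.inclusionL2 (hL2 j) (f n j)‖) atTop (𝓝 0)) :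
    ∃ (j : ι) (k : ℕ → ℕ) (φ : ℕ → (ρ j).space 𝕜), StrictMono k ∧
      EquivalentSeq 𝕜 (f ∘ k) φ ∧ IsUnconditionalBasicSequence 𝕜 φ ∧
      DisjointlySupported (fun n => (φ n : Ω j →ₘ[μ j] 𝕜)) ∧
      (∀ n, IsSimple (φ n : Ω j →ₘ[μ j] 𝕜)) ∧
      (μ j Set.univ < ∞ → EscapesToInfinity (fun n => (φ n : Ω j →ₘ[μ j] 𝕜))) := by
  obtain ⟨c, D, hc, hcD⟩ := hnorm
  obtain ⟨j₀, d, k₁, hd, hk₁, hdf, hzero⟩ := exists_first_coordinate hc fun n => (hcD n).1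
  -- The perturbations have size at most `d / 2`, so the models at `j₀` keep norm at least `d / 2`.
  set δ : ℝ := d / 2 with hδ
  have hδ0 : 0 < δ := half_pos hd
  -- The property survives further extraction because `n ≤ l n` only improves the bound `(1 / 2) ^
  -- n`; the coordinates can thus be treated one after another.
  obtain ⟨k₂, hk₂, hP⟩ := exists_common_subsequence
    (fun j k => ∃ φ : ℕ → (ρ j).space 𝕜, (∀ n, ‖f (k₁ (k n)) j - φ n‖ ≤ δ * (1 / 2) ^ n) ∧
      (j < j₀ → φ = 0) ∧ DisjointlySupported (fun n => (φ n : Ω j →ₘ[μ j] 𝕜)) ∧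
      (j₀ ≤ j → (∀ n, IsSimple (φ n : Ω j →ₘ[μ j] 𝕜)) ∧
        (μ j Set.univ < ∞ → EscapesToInfinity (fun n => (φ n : Ω j →ₘ[μ j] 𝕜)))))
    (by
      rintro j k l hl ⟨φ, h1, h2, h3, h4⟩
      refine ⟨φ ∘ l, fun n => (h1 (l n)).trans ?_, fun h => by rw [h2 h]; rfl,
        fun m n hmn => h3 _ _ (hl.injective.ne hmn), fun h => ⟨fun n => (h4 h).1 _, fun hfin =>
          ((h4 h).2 hfin).comp hl.tendsto_atTop⟩⟩
      exact mul_le_mul_of_nonneg_left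
        (pow_le_pow_of_le_one (by norm_num) (by norm_num) hl.le_apply) hδ0.le)
    (by
      intro j k hk
      rcases lt_or_ge j j₀ with hj | hj
      · obtain ⟨l, hl, hlP⟩ := extraction_forall_of_eventually fun n : ℕ =>
          ((hzero j hj).comp hk.tendsto_atTop).eventually
            (gt_mem_nhds (show 0 < δ * (1 / 2) ^ n by positivity))
        refine ⟨l, hl, 0, fun n => ?_, fun _ => rfl, fun m n _ => ?_, fun h => absurd hj h.not_gt⟩
        · rw [Pi.zero_apply, sub_zero]
          exact (hlP n).le
        · filter_upwards [AEEqFun.coeFn_zero (α := Ω j) (β := 𝕜) (μ := μ j)] with ω h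
          exact Or.inl h
      · obtain ⟨l₁, hl₁, hae⟩ := FunctionNorm.exists_subsequence_ae_tendsto (hL2 j)
          ((hf2 j).comp (hk₁.comp hk).tendsto_atTop)
        obtain ⟨l₂, hl₂, φ, h1, h2, h3, h4⟩ := (hoc j).exists_disjoint_simple_subsequence
          (fun n => f (k₁ (k (l₁ n))) j) hae (ENNReal.ofReal_pos.2 hδ0)
        refine ⟨l₁ ∘ l₂, hl₁.comp hl₂, φ, fun n => ?_, fun h => absurd h hj.not_gt, h2,
          fun _ => ⟨h3, h4⟩⟩
        have := h1 n
        rw [← ofReal_norm, ← ENNReal.ofReal_ofNat, ← ENNReal.ofReal_inv_of_pos two_pos,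
          ← ENNReal.ofReal_pow (by positivity), ← ENNReal.ofReal_mul hδ0.le,
          ENNReal.ofReal_le_ofReal_iff (by positivity)] at this
        rw [one_div]
        exact this)
  choose φ hφ hφ0 hφd hφs using hP
  have hk : StrictMono (k₁ ∘ k₂) := hk₁.comp hk₂
  set x : ℕ → ∀ j, (ρ j).space 𝕜 := f ∘ (k₁ ∘ k₂) with hx
  have hKx : ∀ (a : ℕ → 𝕜) (s t : Finset ℕ), s ⊆ t →
      ‖∑ i ∈ s, a i • x i‖ ≤ K * ‖∑ i ∈ t, a i • x i‖ := norm_sum_le_comp hK hk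
  have hpow : ∀ n : ℕ, ((1 : ℝ) / 2) ^ n ≤ 1 := fun n => pow_le_one₀ (by norm_num) (by norm_num)
  have hφlow : ∀ n, δ ≤ ‖φ j₀ n‖ := fun n => by
    have h1 := hdf (k₂ n)
    have h2 := norm_sub_norm_le (f (k₁ (k₂ n)) j₀) (φ j₀ n)
    have h3 : δ * (1 / 2) ^ n ≤ δ := mul_le_of_le_one_right hδ0.le (hpow n)
    have h4 := hφ j₀ n
    have h5 : d = δ + δ := (add_halves d).symm
    linarith
  have hφup : ∀ j n, ‖φ j n‖ ≤ D + δ := fun j n => by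
    have h1 := (norm_le_pi_norm (f (k₁ (k₂ n))) j).trans (hcD _).2
    have h2 := norm_sub_norm_le (φ j n) (f (k₁ (k₂ n)) j)
    have h3 : δ * (1 / 2) ^ n ≤ δ := mul_le_of_le_one_right hδ0.le (hpow n)
    have h4 := hφ j n
    rw [norm_sub_rev] at h2
    linarith
  have hxcoeff : ∀ (m : ℕ) (a : ℕ → 𝕜), ∀ i < m,
      ‖a i‖ ≤ K / c * ‖∑ i ∈ Finset.range m, a i • x i‖ := fun m a i hi => by
    have h1 := hKx a {i} (Finset.range m) (by simpa using hi)
    rw [Finset.sum_singleton, norm_smul] at h1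
    rw [div_mul_eq_mul_div, le_div_iff₀ hc]
    exact (mul_le_mul_of_nonneg_left (hcD _).1 (norm_nonneg _)).trans h1
  have hφcoeff : ∀ (m : ℕ) (a : ℕ → 𝕜), ∀ i < m,
      ‖a i‖ ≤ 1 / δ * ‖∑ i ∈ Finset.range m, a i • φ j₀ i‖ := fun m a i hi => by
    have h1 := FunctionNorm.norm_sum_le_of_subset (hφd j₀) a (s := {i}) (t := Finset.range m)
      (by simpa using hi)
    rw [Finset.sum_singleton, norm_smul] at h1
    rw [div_mul_eq_mul_div, le_div_iff₀ hδ0, one_mul]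
    exact (mul_le_mul_of_nonneg_left (hφlow i) (norm_nonneg _)).trans h1
  -- Models before `j₀` are zero; models after it are controlled by the pair of estimates.
  have hcomp : ∀ j, ∃ M : ℝ, 0 ≤ M ∧ ∀ (m : ℕ) (a : ℕ → 𝕜),
      ‖∑ i ∈ Finset.range m, a i • φ j i‖ ≤ M * ‖∑ i ∈ Finset.range m, a i • φ j₀ i‖ := by
    intro j
    rcases lt_trichotomy j j₀ with hj | rfl | hj
    · refine ⟨0, le_rfl, fun m a => ?_⟩
      simp [hφ0 j hj]
    · exact ⟨1, zero_le_one, fun m a => by rw [one_mul]⟩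
    · obtain ⟨p, q, hp, hpq, hlow, hup⟩ := hest j₀ j hj
      exact exists_norm_sum_le_of_estimates hp hpq hlow hup (hφd j₀) (hφd j) hδ0 hφlow (hφup j)
  choose M hM0 hM using hcomp
  refine ⟨j₀, k₁ ∘ k₂, φ j₀, hk, ⟨?_, ?_⟩, ?_, hφd j₀, (hφs j₀ le_rfl).1, (hφs j₀ le_rfl).2⟩
  · refine dominates_of_norm_sum_le (1 + 2 * δ * (K / c)) fun m a => ?_
    have h1 := norm_sum_smul_le_add (x := φ j₀) (y := fun n => x n j₀) hδ0.le
      (R := K / c * ‖∑ i ∈ Finset.range m, a i • x i‖) (by positivity)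
      (fun n => by rw [norm_sub_rev]; exact hφ j₀ n) (hxcoeff m a)
    have h2 := norm_le_pi_norm (∑ i ∈ Finset.range m, a i • x i) j₀
    simp only [Finset.sum_apply, Pi.smul_apply] at h2
    linarith
  · refine dominates_of_norm_sum_le (∑ j, M j + 2 * δ * (1 / δ)) fun m a => ?_
    refine (pi_norm_le_iff_of_nonneg ?_).2 fun j => ?_
    · have := Finset.sum_nonneg fun j (_ : j ∈ Finset.univ) => hM0 j
      positivity
    · have h1 := norm_sum_smul_le_add (x := fun n => x n j) (y := φ j) hδ0.le
        (R := 1 / δ * ‖∑ i ∈ Finset.range m, a i • φ j₀ i‖) (by positivity)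
        (hφ j) (hφcoeff m a)
      have h2 : M j * ‖∑ i ∈ Finset.range m, a i • φ j₀ i‖ ≤
          (∑ j, M j) * ‖∑ i ∈ Finset.range m, a i • φ j₀ i‖ :=
        mul_le_mul_of_nonneg_right
          (Finset.single_le_sum (fun j _ => hM0 j) (Finset.mem_univ j)) (norm_nonneg _)
      have h3 := hM j m a
      simp only [Finset.sum_apply, Pi.smul_apply]
      linarith
  · refine isUnconditionalBasicSequence_of_norm_sum_le 1 (fun n => ?_) fun a s t hst => ?_
    · exact norm_pos_iff.1 (hδ0.trans_le (hφlow n))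
    · rw [one_mul]
      exact FunctionNorm.norm_sum_le_of_subset (hφd j₀) a hst

end directSum

end

/-! ### The dichotomy -/

theorem mainTheorem5 {𝕜 : Type*} [RCLike 𝕜] (N : ℕ) {Ω : Fin (N + 1) → Type*}
    [∀ j, MeasurableSpace (Ω j)] (μ : ∀ j, Measure (Ω j)) [∀ j, SigmaFinite (μ j)]
    (ρ : ∀ j, FunctionNorm (μ j))
    (p : Fin N → ℝ) (hp_mono : StrictMono p) (hp : ∀ j, 2 < p j)
    (hL2 : ∀ j, ((ρ j).space 𝕜).toAddSubgroup ≤ Lp 𝕜 2 (μ j))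
    (htype : ∀ j, HasRademacherType ((ρ j).space 𝕜) 2)
    (hconvex : (ρ 0).LatticeConvex 2)
    (hconcave : (ρ (Fin.last N)).NontrivialConcavity)
    (hlower : ∀ j : Fin N, (ρ j.castSucc).LowerEstimate (p j))
    (hupper : ∀ j : Fin N, (ρ j.succ).UpperEstimate (p j))
    (ψ : ℕ → ∀ j, (ρ j).space 𝕜)
    (hψ_norm : SemiNormalized ψ) (hψ_basic : IsUnconditionalBasicSequence 𝕜 ψ) :
    EquivalentSeq 𝕜 ψ (unitVectors 𝕜) ∨
      ∃ (j : Fin (N + 1)) (k : ℕ → ℕ) (φ : ℕ → (ρ j).space 𝕜),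
        StrictMono k ∧
        EquivalentSeq 𝕜 (ψ ∘ k) φ ∧
        IsUnconditionalBasicSequence 𝕜 φ ∧
        DisjointlySupported (fun n => (φ n : Ω j →ₘ[μ j] 𝕜)) ∧
        (∀ n, IsSimple (φ n : Ω j →ₘ[μ j] 𝕜)) ∧
        (μ j Set.univ < ∞ → EscapesToInfinity (fun n => (φ n : Ω j →ₘ[μ j] 𝕜))) := by

  classical
  have hoc : ∀ j, (ρ j).OrderContinuous := fun j => by
    rcases eq_or_ne j (Fin.last N) with rfl | hj
    · obtain ⟨r, hr, hcr⟩ := hconcave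
      exact (hcr.lowerEstimate hr).orderContinuous (by linarith)
    · obtain ⟨i, rfl⟩ := Fin.exists_castSucc_eq.2 hj
      exact (hlower i).orderContinuous (by linarith [hp i])
  have hest : ∀ i j, i < j → ∃ p q : ℝ, 0 < p ∧ p ≤ q ∧ (ρ i).LowerEstimate p ∧
      (ρ j).UpperEstimate q := fun i j hij => by
    -- The lower exponent of a space has its own index and the upper exponent the preceding one; `i
    -- < j` then gives `p i ≤ p j` after reindexing, with equality for neighbours.
    obtain ⟨i, rfl⟩ := Fin.exists_castSucc_eq.2 (hij.trans_le (Fin.le_last j)).ne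
    obtain ⟨j, rfl⟩ := Fin.exists_succ_eq.2 ((Fin.zero_le _).trans_lt hij).ne'
    exact ⟨p i, p j, by linarith [hp i], hp_mono.monotone (Fin.castSucc_lt_succ_iff.1 hij),
      hlower i, hupper j⟩
  let T : ∀ j, (∀ j, (ρ j).space 𝕜) →L[𝕜] Lp 𝕜 2 (μ j) := fun j =>
    (FunctionNorm.inclusionL2 (hL2 j)).comp (ContinuousLinearMap.proj j)
  have hT : ∀ j n, T j (ψ n) = FunctionNorm.inclusionL2 (hL2 j) (ψ n j) := fun _ _ => rfl
  by_cases hcase : ∃ c : ℝ, 0 < c ∧ ∀ n, ∃ j, c ≤ ‖T j (ψ n)‖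
  · left
    obtain ⟨c, hc, hcT⟩ := hcase
    obtain ⟨_, D, _, hD⟩ := hψ_norm
    exact equivalentSeq_unitVectors T (HasRademacherType.pi htype) hψ_basic hc hcT
      fun n => (hD n).2
  · right
    push Not at hcase
    obtain ⟨c, D, hc, hcD⟩ := hψ_norm
    -- Injectivity of the inclusions excludes zero values, so small `L₂` norms must occur along a
    -- genuine subsequence.
    have hpos : ∀ n, 0 < ‖fun j => T j (ψ n)‖ := fun n => by
      refine norm_pos_iff.2 fun h0 => ?_
      have hz : ψ n = 0 := by
        funext j
        refine FunctionNorm.inclusionL2_injective (hL2 j) ?_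
        rw [← hT, Pi.zero_apply, map_zero]
        exact congrFun h0 j
      have := (hcD n).1
      rw [hz, norm_zero] at this
      linarith
    obtain ⟨k, hk, hlim⟩ := exists_subsequence_tendsto_zero hpos fun c hc => by
      obtain ⟨n, hn⟩ := hcase c hc
      exact ⟨n, (pi_norm_lt_iff hc).2 hn⟩
    obtain ⟨K, hK0, hK⟩ := hψ_basic.exists_norm_sum_le
    obtain ⟨j, l, φ, hl, h⟩ := exists_coordinate_equivalentSeq hL2 hoc hest (f := ψ ∘ k)
      ⟨c, D, hc, fun n => hcD (k n)⟩ hK0 (norm_sum_le_comp hK hk) fun j =>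
        squeeze_zero (fun _ => norm_nonneg _)
          (fun n => norm_le_pi_norm (fun j => T j (ψ (k n))) j) hlim
    exact ⟨j, k ∘ l, φ, hk.comp hl, h⟩
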